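/- Let $Q$ be a free abelian group equipped with a total order compatible with addition, let $\pi:Q\to\mathbb{Z}$ be a group homomorphism preserving the (weak) order, and let $\mathfrak{g}=\bigoplus_{\alpha\in Q}\mathfrak{g}_\alpha$ be a $Q$-graded Lie algebra over $\mathbb{C}$ with center $Z$. Put $\mathfrak{n}=\bigoplus_{\pi(\alpha)>0}\mathfrak{g}_\alpha$, $\mathfrak{b}_-=\bigoplus_{\pi(\alpha)\le 0}\mathfrak{g}_\alpha$ and $Z''=Z\cap\mathfrak{b}_-$. Assume that $\mathfrak{g}$ is $Q$-good: $\dim\mathfrak{g}_\alpha\le 1$ if $\pi(\alpha)>0$, and $\dim(\mathfrak{g}/Z)_\alpha\le 1$ if $\pi(\alpha)\le 0$. Let $K=\{\alpha\in Q:\mathfrak{g}_\alpha\ne 0\}$, $K'=\{\alpha\in K:\pi(\alpha)>0\}$, $K''=\{\alpha\in K:\pi(\alpha)\le 0\}$ and $R''=\{\alpha\in K'':\mathfrak{g}_\alpha\subseteq Z\}$, and for each $\alpha\in K\setminus R''$ fix a nonzero $x_\alpha\in\mathfrak{g}_\alpha$ with $x_\alpha\notin Z''$. Let $\varphi:\mathfrak{n}\to\mathbb{C}$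 be a homomorphism of Lie algebras. Assume that $(\mathfrak{g},\pi)$ is nonsingular with respect to $\varphi$, that is: (1) the set $\{\alpha\in K':\varphi(x_\alpha)\ne 0\}$ has a unique maximal element $\alpha_\varphi$; (2) for every $\beta\in K''\setminus R''$ there is $y\in\mathfrak{g}_{\alpha_\varphi-\beta}$ (so $y\in\mathfrak{n}$) with $\varphi([y,x_\beta])\ne 0$. A Whittaker module of type $\varphi$ is a $\mathfrak{g}$-module generated by a vector $v$ such that $xv=\varphi(x)v$ for all $x\in\mathfrak{n}$. Let $M_\varphi=U(\mathfrak{g})\otimes_{U(\mathfrak{n})}\mathbb{C}_\varphi$, where $\mathbb{C}_\varphi$ is the one-dimensional $\mathfrak{n}$-module given by $\varphi$; the symmetric algebra $S(Z'')$ acts on $M_\varphi$ through its canonical map to the center of $U(\mathfrak{g})$. Then for every maximal ideal $\mathfrak{m}$ of $S(Z'')$ the $\mathfrak{g}$-module $M_\varphi/\mathfrak{m}M_\varphi$ is a simple Whittaker module of type $\varphi$, and every simple Whittaker module of type $\varphi$ is isomorphic to $M_\varphi/\mathfrak{m}M_\varphi$ for exactly one maximal ideal $\mathfrak{m}$ of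 $S(Z'')$. -/

import Mathlib

open scoped TensorProduct

attribute [local instance 100] LieRing.ofAssociativeRing

noncomputable section

namespace Whittaker

universe u v w

section GradedLie

variable {Q : Type w} [AddCommGroup Q] [LinearOrder Q] [IsOrderedAddMonoid Q]
variable {g : Type u} [LieRing g] [LieAlgebra ℂ g]
variable (G : Q → Submodule ℂ g) [GradedLieAlgebra G] (π : Q →+o ℤ)

/-- The sum of the homogeneous components whose degree lies in an additively closed set `S`,
as a Lie subalgebra. -/
def gradedPart (S : Set Q) (hS : ∀ a ∈ S, ∀ b ∈ S, a + b ∈ S) : LieSubalgebra ℂ g :=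
  { (⨆ a ∈ S, G a : Submodule ℂ g) with
    lie_mem' := by
      intro x y hx hy
      simp only [AddSubsemigroup.mem_carrier, AddSubmonoid.mem_toSubsemigroup,
        Submodule.mem_toAddSubmonoid] at hx hy ⊢
      rw [iSup_subtype'] at hx hy
      induction hx using Submodule.iSup_induction' with
      | zero => simp
      | add x₁ x₂ _ _ h₁ h₂ => rw [add_lie]; exact Submodule.add_mem _ h₁ h₂
      | mem i x hx =>
        induction hy using Submodule.iSup_induction' with
        | zero => simp
        | add y₁ y₂ _ _ h₁ h₂ => rw [lie_add]; exact Submodule.add_mem _ h₁ h₂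
        | mem j y hy =>
          exact Submodule.mem_iSup_of_mem _ (Submodule.mem_iSup_of_mem (hS i i.2 j j.2)
            (SetLike.GradedBracket.bracket_mem hx hy)) }

/-- `𝔫`, the sum of the components of degree `α` with `π α > 0`. -/
def posPart : LieSubalgebra ℂ g :=
  gradedPart G {a | 0 < π a} (by
    intro a ha b hb
    simp only [Set.mem_ofPred_eq, map_add] at *
    omega)

/-- `𝔟₋`, the sum of the components of degree `α` with `π α ≤ 0`. -/
def nonposPart : LieSubalgebra ℂ g :=
  gradedPart G {a | π a ≤ 0} (by
    intro a ha b hb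
    simp only [Set.mem_ofPred_eq, map_add] at *
    omega)

/-- `Z ∩ 𝔟`, where `Z` is the center of `𝔤`. For `𝔟 = 𝔟₋` this is `Z''`. -/
def centralPart (b : LieSubalgebra ℂ g) : Submodule ℂ g :=
  (LieAlgebra.center ℂ g).toSubmodule ⊓ b.toSubmodule

/-- `𝔤` is `Q`-good: `dim 𝔤_α ≤ 1` when `π α > 0`, and `dim (𝔤/Z)_α ≤ 1` when `π α ≤ 0`;
here `(𝔤/Z)_α` is the image of `𝔤_α` in `𝔤/Z`. -/
structure IsGood : Prop where
  rank_pos : ∀ a : Q, 0 < π a → Module.rank ℂ (G a) ≤ 1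
  rank_nonpos : ∀ a : Q, π a ≤ 0 →
    Module.rank ℂ ((G a).map (LieAlgebra.center ℂ g).toSubmodule.mkQ) ≤ 1

/-- `K`, the set of degrees `α` with `𝔤_α ≠ 0`. -/
def degrees : Set Q := {a | G a ≠ ⊥}

/-- `K' = K ∩ Q'`. -/
def posDegrees : Set Q := {a | a ∈ degrees G ∧ 0 < π a}

/-- `R`, the set of degrees `α ∈ K` with `Z ∩ 𝔤_α = 𝔤_α`. -/
def centralDegrees : Set Q :=
  {a | a ∈ degrees G ∧ (LieAlgebra.center ℂ g).toSubmodule ⊓ G a = G a}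

/-- `K''`, the set of degrees `α ∈ K` with `π α ≤ 0`. -/
def nonposDegrees : Set Q := {a | a ∈ degrees G ∧ π a ≤ 0}

/-- `R'' = R ∩ K''`. -/
def centralNonposDegrees : Set Q := centralDegrees G ∩ nonposDegrees G π

/-- `x` is a choice, for every `α ∈ K \ R''`, of a nonzero element `x α` of `𝔤_α` which is
not in `Z''`. (The values of `x` at the other degrees are irrelevant.) -/
structure IsChoice (x : Q → g) : Prop where
  mem : ∀ a ∈ degrees G \ centralNonposDegrees G π, x a ∈ G a
  ne_zero : ∀ a ∈ degrees G \ centralNonposDegrees G π, x a ≠ 0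
  notMem : ∀ a ∈ degrees G \ centralNonposDegrees G π, x a ∉ centralPart (nonposPart G π)

/-- The set of degrees `α ∈ K'` with `φ (x α) ≠ 0`. -/
def support (x : Q → g) (φ : LieAlgebra.LieCharacter ℂ (posPart G π)) : Set Q :=
  {a | a ∈ posDegrees G π ∧ ∃ h : x a ∈ posPart G π, φ ⟨x a, h⟩ ≠ 0}

/-- `(𝔤, π)` is nonsingular with respect to the character `φ` of `𝔫`: the set
`{α ∈ K' | φ (x α) ≠ 0}` has a unique maximal element `αφ`, and for every `β ∈ K'' \ R''` there
is `y ∈ 𝔫` of degree `αφ - β` such that `φ ⁅y, x β⁆ ≠ 0`. -/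
def IsNonsingular (x : Q → g) (φ : LieAlgebra.LieCharacter ℂ (posPart G π)) : Prop :=
  ∃ aφ : Q, Maximal (· ∈ support G π x φ) aφ ∧
    (∀ a, Maximal (· ∈ support G π x φ) a → a = aφ) ∧
    ∀ b ∈ nonposDegrees G π \ centralNonposDegrees G π,
      ∃ y ∈ posPart G π, y ∈ G (aφ - b) ∧
        ∃ h : ⁅y, x b⁆ ∈ posPart G π, φ ⟨⁅y, x b⁆, h⟩ ≠ 0

end GradedLie

section Modules

variable {g : Type u} [LieRing g] [LieAlgebra ℂ g]
variable {n : LieSubalgebra ℂ g} (φ : LieAlgebra.LieCharacter ℂ n)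

/-- `v` is a Whittaker vector of type `φ`: `x v = φ(x) v` for all `x ∈ 𝔫`. -/
def IsWhittakerVector {V : Type v} [AddCommGroup V] [Module ℂ V] [LieRingModule g V] (v : V) :
    Prop :=
  ∀ x : n, ⁅(x : g), v⁆ = φ x • v

/-- `V` is a Whittaker module of type `φ`: it is generated by a Whittaker vector of type `φ`. -/
def IsWhittakerModule (V : Type v) [AddCommGroup V] [Module ℂ V] [LieRingModule g V] : Prop :=
  ∃ v : V, IsWhittakerVector φ v ∧ LieSubmodule.lieSpan ℂ g {v} = ⊤

/-- The algebra homomorphism `U(𝔫) → U(𝔤)` induced by the inclusion. -/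
def envelopingMap (n : LieSubalgebra ℂ g) :
    UniversalEnvelopingAlgebra ℂ n →ₐ[ℂ] UniversalEnvelopingAlgebra ℂ g :=
  UniversalEnvelopingAlgebra.lift ℂ ((UniversalEnvelopingAlgebra.ι ℂ).comp n.incl)

/-- The relations `u a ⊗ c = u ⊗ a c`, with `a ∈ U(𝔫)`, in `U(𝔤) ⊗_ℂ ℂ`, where `a ∈ U(𝔫)` acts on
`ℂ` through the extension of `φ` to `U(𝔫)`. -/
def balancedRelations :
    Submodule (UniversalEnvelopingAlgebra ℂ g) (UniversalEnvelopingAlgebra ℂ g ⊗[ℂ] ℂ) :=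
  Submodule.span (UniversalEnvelopingAlgebra ℂ g)
    {t | ∃ (u : UniversalEnvelopingAlgebra ℂ g) (a : UniversalEnvelopingAlgebra ℂ n) (c : ℂ),
      t = (u * envelopingMap n a) ⊗ₜ[ℂ] c -
        u ⊗ₜ[ℂ] (UniversalEnvelopingAlgebra.lift ℂ φ a * c)}

/-- The universal Whittaker module `M_φ = U(𝔤) ⊗_{U(𝔫)} ℂ_φ`. -/
abbrev Universal : Type u :=
  (UniversalEnvelopingAlgebra ℂ g ⊗[ℂ] ℂ) ⧸ balancedRelations φ

/-- `M_φ` as a `𝔤`-module. -/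
instance : LieRingModule g (Universal φ) where
  bracket x m := UniversalEnvelopingAlgebra.ι ℂ x • m
  add_lie x y m := by
    rw [map_add, add_smul]
  lie_add x m m' := smul_add _ m m'
  leibniz_lie x y m := by
    change UniversalEnvelopingAlgebra.ι ℂ x • UniversalEnvelopingAlgebra.ι ℂ y • m =
      UniversalEnvelopingAlgebra.ι ℂ ⁅x, y⁆ • m +
        UniversalEnvelopingAlgebra.ι ℂ y • UniversalEnvelopingAlgebra.ι ℂ x • m
    rw [LieHom.map_lie, LieRing.of_associative_ring_bracket, sub_smul, mul_smul, mul_smul,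
      sub_add_cancel]

theorem lie_eq_smul (x : g) (m : Universal φ) :
    ⁅x, m⁆ = UniversalEnvelopingAlgebra.ι ℂ x • m := rfl

instance : LieModule ℂ g (Universal φ) where
  smul_lie t x m := by rw [lie_eq_smul, lie_eq_smul, map_smul, smul_assoc]
  lie_smul t x m := by rw [lie_eq_smul, lie_eq_smul, smul_algebra_smul_comm]

theorem ι_mem_center {z : g} (hz : z ∈ LieAlgebra.center ℂ g) :
    UniversalEnvelopingAlgebra.ι ℂ z ∈
      Subalgebra.center ℂ (UniversalEnvelopingAlgebra ℂ g) := by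
  rw [Subalgebra.mem_center_iff]
  intro b
  let S : Subalgebra ℂ (UniversalEnvelopingAlgebra ℂ g) :=
    Subalgebra.centralizer ℂ {UniversalEnvelopingAlgebra.ι ℂ z}
  have hS : ∀ y : g, UniversalEnvelopingAlgebra.ι ℂ y ∈ S := by
    intro y
    rw [Subalgebra.mem_centralizer_iff]
    rintro _ rfl
    have h : ⁅z, y⁆ = 0 := by
      rw [← lie_skew, (LieModule.mem_maxTrivSubmodule (R := ℂ) (L := g) (M := g) z).1 hz y,
        neg_zero]
    have h2 := (UniversalEnvelopingAlgebra.ι ℂ : g →ₗ⁅ℂ⁆ _).map_lie z y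
    rw [h, map_zero, LieRing.of_associative_ring_bracket] at h2
    exact (sub_eq_zero.1 h2.symm)
  let f : g →ₗ⁅ℂ⁆ S :=
    { toFun := fun y => ⟨UniversalEnvelopingAlgebra.ι ℂ y, hS y⟩
      map_add' := fun x y => Subtype.ext (map_add _ x y)
      map_smul' := fun t x => Subtype.ext (map_smul _ t x)
      map_lie' := fun {x y} => Subtype.ext (LieHom.map_lie _ x y) }
  have h : S.val.comp (UniversalEnvelopingAlgebra.lift ℂ f) = AlgHom.id ℂ _ := by
    apply UniversalEnvelopingAlgebra.hom_ext
    ext y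
    change ((UniversalEnvelopingAlgebra.lift ℂ f (UniversalEnvelopingAlgebra.ι ℂ y) : S) :
      UniversalEnvelopingAlgebra ℂ g) = UniversalEnvelopingAlgebra.ι ℂ y
    rw [UniversalEnvelopingAlgebra.lift_ι_apply]
    rfl
  have hb : b ∈ S := by
    have := DFunLike.congr_fun h b
    rw [← show _ = b from this]
    exact (UniversalEnvelopingAlgebra.lift ℂ f b).2
  exact ((Subalgebra.mem_centralizer_iff ℂ).1 hb _ rfl).symm

/-- The canonical algebra homomorphism from `S(Z'')` to the center of `U(𝔤)`,
where `Z'' = Z ∩ 𝔟`. -/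
def symToCenter (b : LieSubalgebra ℂ g) :
    SymmetricAlgebra ℂ (centralPart b) →ₐ[ℂ]
      Subalgebra.center ℂ (UniversalEnvelopingAlgebra ℂ g) :=
  SymmetricAlgebra.lift
    { toFun := fun z => ⟨UniversalEnvelopingAlgebra.ι ℂ (z : g), ι_mem_center z.2.1⟩
      map_add' := fun x y => Subtype.ext (map_add _ (x : g) (y : g))
      map_smul' := fun t x => Subtype.ext (map_smul _ t (x : g)) }

/-- The `𝔤`-submodule `I M_φ` of `M_φ`, for an ideal `I` of `S(Z'')`: the span of the vectors
`a m` with `a ∈ I` and `m ∈ M_φ`. -/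
def idealSMul (b : LieSubalgebra ℂ g) (I : Ideal (SymmetricAlgebra ℂ (centralPart b))) :
    LieSubmodule ℂ g (Universal φ) :=
  { Submodule.span ℂ {m : Universal φ | ∃ a ∈ I, ∃ m' : Universal φ,
      m = (symToCenter b a : UniversalEnvelopingAlgebra ℂ g) • m'} with
    lie_mem := by
      intro x m hm
      simp only [AddSubsemigroup.mem_carrier, AddSubmonoid.mem_toSubsemigroup,
        Submodule.mem_toAddSubmonoid] at hm ⊢
      induction hm using Submodule.span_induction with
      | zero => simp
      | add m₁ m₂ _ _ h₁ h₂ => rw [lie_add]; exact Submodule.add_mem _ h₁ h₂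
      | smul t m₁ _ h => rw [lie_smul]; exact Submodule.smul_mem _ _ h
      | mem m hm =>
        obtain ⟨a, ha, m', rfl⟩ := hm
        refine Submodule.subset_span ⟨a, ha, ⁅x, m'⁆, ?_⟩
        rw [lie_eq_smul, lie_eq_smul, smul_smul, smul_smul,
          (Subalgebra.mem_center_iff.1 (symToCenter b a).2 _)] }

/-- The `𝔤`-module `L_{φ,I} = M_φ / I M_φ`. -/
abbrev UniversalQuotient (b : LieSubalgebra ℂ g)
    (I : Ideal (SymmetricAlgebra ℂ (centralPart b))) : Type u :=
  Universal φ ⧸ idealSMul φ b I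

end Modules

end Whittaker

end

/-! Write A = S(Z''), and give x_β, for β in K'' \ R'', the weight α_φ - β, which is positive. Let v
be a Whittaker vector generating V, and let A act on V through A/I.

The monomials in the x_β, applied to v, span V over A/I. Modulo lower weight the x_β commute. If b
is the smallest index occurring in a polynomial and y has degree α_φ - b, then y - φ(y) acts on the
leading part as φ([y, x_b]) ∂/∂x_b: for c > b the bracket [y, x_c] has degree above α_φ, where φ
vanishes. Nonsingularity provides a y for which this scalar is nonzero, so repeated differentiation
turns every nonzero polynomial in the x_β applied to v into b • v with b ≠ 0 in A/I
(`WhittakerData.exists_smul_mem`). Hence every nonzero submodule contains some r v with r outside I.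
If moreover I is the exact annihilator of v, the monomials form a basis over A/I
(`WhittakerData.theta_injective`, `WhittakerData.theta_surjective`).

For I maximal, r is invertible modulo I, so M_φ / I M_φ is simple once it is nonzero. Nonvanishing
is of Poincaré–Birkhoff–Witt type: the character of 𝔫 + Z'' with values in A/I is induced to 𝔤 by an
explicit action on polynomials (`Induced.exists_representation`, `univGen_notMem`).

Conversely, let V be simple and I its annihilator in A. An r outside I acts surjectively, so r m = v
for some m; comparing constant coefficients in the monomial basis inverts r modulo I. Thus I is
maximal (`isMaximal_ker_symAct`), and V, a nonzero quotient of the simple module M_φ / I M_φ, is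
isomorphic to it. Nowhere is A/I required to be ℂ, so no form of Schur's lemma over ℂ is needed. -/

noncomputable section

set_option linter.unusedSectionVars false

namespace Whittaker

/-! ### Induced modules on polynomial rings, by a Poincaré–Birkhoff–Witt argument -/

namespace Induced

open Module

variable {K L R ι κ : Type*} [Field K] [LieRing L] [LieAlgebra K L] [CommRing R] [Algebra K R]

/-- The basis vector attached to a multiset. -/
abbrev mon (R : Type*) [CommRing R] (M : Multiset ι) : Multiset ι →₀ R := Finsupp.single M 1

/-- The linear span of the monomials of degree at most `n`. -/
abbrev degLE (R ι : Type*) [CommRing R] (n : ℕ) : Submodule R (Multiset ι →₀ R) :=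
  Finsupp.supported R R {M | M.card ≤ n}

theorem degLE_mono {m n : ℕ} (h : m ≤ n) : degLE R ι m ≤ degLE R ι n :=
  Finsupp.supported_mono fun _ hM => le_trans hM h

theorem mon_mem {M : Multiset ι} {n : ℕ} (h : M.card ≤ n) : mon R M ∈ degLE R ι n :=
  Finsupp.single_mem_supported R 1 h

theorem degLE_induction {n : ℕ} {N : Type*} [AddCommGroup N] [Module R N]
    {f g : (Multiset ι →₀ R) →ₗ[R] N} (h : ∀ M : Multiset ι, M.card ≤ n → f (mon R M) = g (mon R M))
    {x : Multiset ι →₀ R} (hx : x ∈ degLE R ι n) : f x = g x := by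
  rw [degLE, Finsupp.supported_eq_span_single] at hx
  refine LinearMap.eqOn_span' (f := f) (g := g) ?_ hx
  rintro _ ⟨M, hM, rfl⟩
  exact h M hM

/-- Multiplication by the variable of index `i`; it is zero for an index of the subalgebra. -/
def lead (R : Type*) [CommRing R] : ι ⊕ κ → (Multiset ι →₀ R) →ₗ[R] (Multiset ι →₀ R)
  | .inl a => Finsupp.lmapDomain R R (a ::ₘ ·)
  | .inr _ => 0

@[simp] theorem lead_inl (a : ι) (M : Multiset ι) :
    lead R (Sum.inl a : ι ⊕ κ) (mon R M) = mon R (a ::ₘ M) := by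
  simp [lead, Finsupp.lmapDomain_apply, Finsupp.mapDomain_single]

@[simp] theorem lead_inr (a : κ) : lead R (Sum.inr a : ι ⊕ κ) = 0 := rfl

theorem lead_mem (i : ι ⊕ κ) {n : ℕ} {x : Multiset ι →₀ R} (hx : x ∈ degLE R ι n) :
    lead R i x ∈ degLE R ι (n + 1) := by
  rw [degLE, Finsupp.supported_eq_span_single] at hx
  have : (Submodule.span R ((fun M => Finsupp.single M (1 : R)) '' {M : Multiset ι | M.card ≤ n})) ≤
      (degLE R ι (n + 1)).comap (lead R i) := by
    rw [Submodule.span_le]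
    rintro _ ⟨M, hM, rfl⟩
    rcases i with a | a
    · rw [SetLike.mem_coe, Submodule.mem_comap, lead_inl]
      exact mon_mem (by simpa using hM)
    · simp
  exact this hx

theorem linearCombination_mem {n : ℕ} {f : Multiset ι → (Multiset ι →₀ R)}
    (hf : ∀ M : Multiset ι, M.card ≤ n → f M ∈ degLE R ι M.card)
    {x : Multiset ι →₀ R} (hx : x ∈ degLE R ι n) :
    Finsupp.linearCombination R f x ∈ degLE R ι n := by
  rw [Finsupp.linearCombination_apply]
  refine Submodule.sum_mem _ fun M hM => Submodule.smul_mem _ _ ?_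
  have : M.card ≤ n := (Finsupp.mem_supported R x).1 hx hM
  exact degLE_mono this (hf M this)

theorem linearCombination_congr {n : ℕ} {f g : Multiset ι → (Multiset ι →₀ R)}
    (h : ∀ M : Multiset ι, M.card ≤ n → f M = g M) {x : Multiset ι →₀ R} (hx : x ∈ degLE R ι n) :
    Finsupp.linearCombination R f x = Finsupp.linearCombination R g x :=
  degLE_induction (fun M hM => by simp [h M hM]) hx

variable [LinearOrder ι]

/-- The index `i` is a variable which is at most `k`. -/
def IsLE : ι ⊕ κ → ι → Prop
  | .inl a, k => a ≤ k
  | .inr _, _ => False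

open Classical in
/-- The lower order part of the action of a basis vector on a monomial, with a recursion depth
bounded by the first argument. -/
def lowAux (e : Basis (ι ⊕ κ) K L) (c : κ → R) : ℕ → ι ⊕ κ → Multiset ι → (Multiset ι →₀ R)
  | 0, i, _ => i.elim (fun _ => 0) (fun a => c a • mon R 0)
  | n + 1, i, M =>
    match M.sort with
    | [] => i.elim (fun _ => 0) (fun a => c a • mon R 0)
    | k :: l =>
      -- In order, the product is already a monomial. Otherwise the relation e_i e_k = e_k e_i +
      -- [e_i, e_k] is imposed; the part of e_k e_i coming from the top term of e_i is a monomial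
      -- supplied by `lead`. Indices of the subalgebra come after all variables.
      if IsLE i k then 0 else
        lead R (Sum.inl k : ι ⊕ κ) (lowAux e c n i l) +
          Finsupp.linearCombination R (lowAux e c n (.inl k)) (lowAux e c n i l) +
          (e.repr ⁅e i, e (.inl k)⁆).sum fun j t => t • (lead R j (mon R l) + lowAux e c n j l)

variable (e : Basis (ι ⊕ κ) K L) (c : κ → R)

/-- This degree bound justifies the nested recursion: the inner call is made on monomials no longer
than the tail `l`, so the remaining depth suffices. -/
theorem lowAux_mem (n : ℕ) (i : ι ⊕ κ) (M : Multiset ι) (hM : M.card ≤ n) :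
    lowAux e c n i M ∈ degLE R ι M.card := by
  have hbase : ∀ m, (i.elim (fun _ => 0) (fun a => c a • mon R 0) : Multiset ι →₀ R) ∈
      degLE R ι m := by
    intro m
    rcases i with a | a
    · exact Submodule.zero_mem _
    · exact Submodule.smul_mem _ _ (mon_mem (by simp))
  induction n generalizing i M with
  | zero => rw [lowAux]; exact hbase _
  | succ n ih =>
    rw [lowAux]
    have hbase' : ∀ (i : ι ⊕ κ) m, (i.elim (fun _ => 0) (fun a => c a • mon R 0) :
        Multiset ι →₀ R) ∈ degLE R ι m := by
      rintro (a | a) m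
      · exact Submodule.zero_mem _
      · exact Submodule.smul_mem _ _ (mon_mem (by simp))
    replace ih := fun i M hM => ih i M hM (hbase' i)
    split
    · exact hbase _
    · rename_i k l hs
      have hM' : M = k ::ₘ (l : Multiset ι) := by
        rw [← Multiset.sort_eq M (· ≤ ·), hs]; rfl
      have hl : Multiset.card (l : Multiset ι) ≤ n := by
        rw [hM', Multiset.card_cons] at hM; omega
      split
      · exact Submodule.zero_mem _
      · have hc : M.card = Multiset.card (l : Multiset ι) + 1 := by rw [hM', Multiset.card_cons]
        rw [hc]
        have h1 := ih i l hl
        refine Submodule.add_mem _ (Submodule.add_mem _ (lead_mem _ h1) ?_) ?_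
        · exact degLE_mono (Nat.le_succ _)
            (linearCombination_mem (fun M' hM' => ih _ M' (hM'.trans hl)) h1)
        · refine Submodule.sum_mem _ fun j _ => ?_
          refine Submodule.smul_of_tower_mem _ _ (Submodule.add_mem _ (lead_mem _ (mon_mem le_rfl)) ?_)
          exact degLE_mono (Nat.le_succ _) (ih j l hl)

theorem lowAux_succ (n : ℕ) (i : ι ⊕ κ) (M : Multiset ι) (hM : M.card ≤ n) :
    lowAux e c (n + 1) i M = lowAux e c n i M := by
  induction n generalizing i M with
  | zero =>
    obtain rfl : M = 0 := Multiset.card_eq_zero.1 (by omega)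
    rw [lowAux, lowAux, Multiset.sort_zero]
  | succ n ih =>
    rw [lowAux]
    conv_rhs => rw [lowAux]
    split
    · rfl
    · rename_i k l hs
      have hM' : M = k ::ₘ (l : Multiset ι) := by
        rw [← Multiset.sort_eq M (· ≤ ·), hs]; rfl
      have hl : Multiset.card (l : Multiset ι) ≤ n := by
        rw [hM', Multiset.card_cons] at hM; omega
      congr 1
      rw [ih i l hl, linearCombination_congr (fun M' hM' => ih (.inl k) M' (hM'.trans hl))
        (lowAux_mem e c n i l hl)]
      congr 2
      ext j t
      rw [ih j l hl]

/-- The lower order part of the action of a basis vector on a monomial. -/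
def low (i : ι ⊕ κ) (M : Multiset ι) : Multiset ι →₀ R := lowAux e c M.card i M

theorem lowAux_eq_low {n : ℕ} (i : ι ⊕ κ) {M : Multiset ι} (hM : M.card ≤ n) :
    lowAux e c n i M = low e c i M := by
  induction n, hM using Nat.le_induction with
  | base => rfl
  | succ n hn ih => rw [lowAux_succ e c n i M hn, ih]

theorem low_mem (i : ι ⊕ κ) (M : Multiset ι) : low e c i M ∈ degLE R ι M.card :=
  lowAux_mem e c _ i M le_rfl

/-- The action of a basis vector. -/
def op (i : ι ⊕ κ) : (Multiset ι →₀ R) →ₗ[R] (Multiset ι →₀ R) :=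
  lead R i + Finsupp.linearCombination R (low e c i)

theorem op_mon (i : ι ⊕ κ) (M : Multiset ι) :
    op e c i (mon R M) = lead R i (mon R M) + low e c i M := by
  simp [op]

/-- The action of the Lie algebra. -/
def act : L →ₗ[K] Module.End R (Multiset ι →₀ R) := e.constr K (op e c)

@[simp] theorem act_basis (i : ι ⊕ κ) : act e c (e i) = op e c i := by
  simp [act]

theorem op_inr_zero (a : κ) : op e c (.inr a) (mon R 0) = c a • mon R 0 := by
  rw [op_mon, lead_inr, LinearMap.zero_apply, zero_add, low, Multiset.card_zero, lowAux]
  rfl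

theorem op_inl_of_le {a : ι} {M : Multiset ι} (h : ∀ b ∈ M, a ≤ b) :
    op e c (.inl a) (mon R M) = mon R (a ::ₘ M) := by
  have : low e c (.inl a) M = 0 := by
    rw [← lowAux_eq_low e c (.inl a) (Nat.le_succ M.card), lowAux]
    split
    · rfl
    · rename_i k l hs
      rw [if_pos]
      exact h k (by rw [← Multiset.mem_sort (· ≤ ·), hs]; simp)
  rw [op_mon, this, add_zero, lead_inl]

/-- The recursion rewritten in terms of full operators: the bracket relation holds by definition
when the smallest factor is split off. -/
theorem op_cons {i : ι ⊕ κ} {k : ι} {N : Multiset ι} (hk : ∀ b ∈ N, k ≤ b) (hi : ¬ IsLE i k) :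
    op e c i (mon R (k ::ₘ N)) =
      op e c (.inl k) (op e c i (mon R N)) + act e c ⁅e i, e (.inl k)⁆ (mon R N) := by
  have hN : ((N.sort : List ι) : Multiset ι) = N := N.sort_eq _
  have hlow : low e c i (k ::ₘ N) = lead R (Sum.inl k : ι ⊕ κ) (low e c i N) +
      Finsupp.linearCombination R (low e c (.inl k)) (low e c i N) +
      act e c ⁅e i, e (.inl k)⁆ (mon R N) := by
    rw [low, Multiset.card_cons, lowAux, Multiset.sort_cons _ _ _ hk]
    simp only [if_neg hi, hN]
    rw [lowAux_eq_low e c i le_rfl,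
      linearCombination_congr (fun M' hM' => lowAux_eq_low e c (.inl k) hM') (low_mem e c i N)]
    congr 1
    rw [act, Basis.constr_apply, Finsupp.sum, Finsupp.sum, LinearMap.sum_apply]
    refine Finset.sum_congr rfl fun j _ => ?_
    rw [LinearMap.smul_apply, op_mon, lowAux_eq_low e c j le_rfl]
  have hlead : op e c (.inl k) (lead R i (mon R N)) = lead R i (mon R (k ::ₘ N)) := by
    rcases i with a | a
    · have hka : k < a := not_le.1 hi
      rw [lead_inl, lead_inl, op_inl_of_le, Multiset.cons_swap]
      intro b hb
      rcases Multiset.mem_cons.1 hb with rfl | hb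
      · exact hka.le
      · exact hk b hb
    · simp
  rw [op_mon, hlow, op_mon, map_add, hlead]
  conv_rhs => rw [op]
  simp only [LinearMap.add_apply]
  abel

/-- The bracket relation for two operators on a monomial which both of them follow. -/
theorem op_comm_of_le {i : ι ⊕ κ} {k : ι} {N : Multiset ι} (hk : ∀ b ∈ N, k ≤ b) (hi : ¬ IsLE i k) :
    op e c i (op e c (.inl k) (mon R N)) - op e c (.inl k) (op e c i (mon R N)) =
      act e c ⁅e i, e (.inl k)⁆ (mon R N) := by
  rw [op_inl_of_le e c hk, op_cons e c hk hi, add_sub_cancel_left]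

theorem op_comm_of_le' (i : ι ⊕ κ) {k : ι} {N : Multiset ι} (hk : ∀ b ∈ N, k ≤ b) :
    op e c i (op e c (.inl k) (mon R N)) - op e c (.inl k) (op e c i (mon R N)) =
      act e c ⁅e i, e (.inl k)⁆ (mon R N) := by
  by_cases hi : IsLE i k
  · rcases i with a | a
    · rcases (show a ≤ k from hi).eq_or_lt with rfl | h
      · simp
      · have := op_comm_of_le e c (i := .inl k) (k := a) (N := N)
          (fun b hb => h.le.trans (hk b hb)) (not_le.2 h)
        rw [← lie_skew, map_neg, LinearMap.neg_apply, ← this, neg_sub]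
    · exact hi.elim
  · exact op_comm_of_le e c hk hi

theorem act_comm_extend {f : Multiset ι →₀ R}
    (h : ∀ i j, op e c i (op e c j f) - op e c j (op e c i f) = act e c ⁅e i, e j⁆ f) (u w : L) :
    act e c u (act e c w f) - act e c w (act e c u f) = act e c ⁅u, w⁆ f := by
  have hu : u ∈ Submodule.span K (Set.range e) := by rw [e.span_eq]; trivial
  have hw : w ∈ Submodule.span K (Set.range e) := by rw [e.span_eq]; trivial
  induction hu using Submodule.span_induction with
  | zero => simp
  | add u₁ u₂ _ _ h₁ h₂ => simp only [map_add, LinearMap.add_apply, add_lie, ← h₁, ← h₂]; abel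
  | smul t u _ hu =>
    simp only [map_smul, LinearMap.smul_apply, smul_lie, ← hu, smul_sub,
      LinearMap.map_smul_of_tower]
  | mem u hu =>
    obtain ⟨i, rfl⟩ := hu
    induction hw using Submodule.span_induction with
    | zero => simp
    | add u₁ u₂ _ _ h₁ h₂ => simp only [map_add, LinearMap.add_apply, lie_add, ← h₁, ← h₂]; abel
    | smul t u _ hu =>
      simp only [map_smul, LinearMap.smul_apply, lie_smul, ← hu, smul_sub,
        LinearMap.map_smul_of_tower]
    | mem w hw =>
      obtain ⟨j, rfl⟩ := hw
      simpa using h i j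

variable {e c}

/-- Induction on degree. If one index is at most every factor, the relation is built into the
definition. Otherwise the smallest factor k is split off, both operators are moved past it, and the
Jacobi identity reduces the claim to the remaining monomial. On the empty monomial two subalgebra
elements act by commuting scalars, which is why `hc` is required. -/
theorem op_comm (hc : ∀ a b : κ, act e c ⁅e (.inr a), e (.inr b)⁆ (mon R 0) = 0) (n : ℕ)
    (i j : ι ⊕ κ) {M : Multiset ι} (hM : M.card ≤ n) :
    op e c i (op e c j (mon R M)) - op e c j (op e c i (mon R M)) =
      act e c ⁅e i, e j⁆ (mon R M) := by
  induction n generalizing i j M with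
  | zero =>
    obtain rfl : M = 0 := Multiset.card_eq_zero.1 (by omega)
    rcases j with b | b
    · exact op_comm_of_le' e c i (by simp)
    rcases i with a | a
    · have := op_comm_of_le' e c (.inr b) (k := a) (N := 0) (by simp)
      rw [← lie_skew, map_neg, LinearMap.neg_apply, ← this, neg_sub]
    · rw [hc, op_inr_zero, op_inr_zero, map_smul, map_smul, op_inr_zero, op_inr_zero, smul_smul,
        smul_smul, mul_comm, sub_self]
  | succ n ih =>
    have hcomm : ∀ (u w : L) {f : Multiset ι →₀ R}, f ∈ degLE R ι n →
        act e c u (act e c w f) - act e c w (act e c u f) = act e c ⁅u, w⁆ f := by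
      intro u w f hf
      have := degLE_induction (n := n) (f := act e c u * act e c w - act e c w * act e c u)
        (g := act e c ⁅u, w⁆) (fun M hM => act_comm_extend e c (fun i j => ih i j hM) u w) hf
      simpa using this
    rcases Multiset.empty_or_exists_mem M with rfl | hne
    · exact ih i j (by simp)
    obtain ⟨k, hkM, hk⟩ : ∃ k ∈ M, ∀ b ∈ M, k ≤ b := by
      obtain ⟨a, ha⟩ := hne
      obtain ⟨k, hk⟩ := (M.toFinset).exists_min_image id ⟨a, by simpa using ha⟩
      exact ⟨k, by simpa using hk.1, fun b hb => hk.2 b (by simpa using hb)⟩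
    by_cases hj : IsLE j k
    · rcases j with b | b
      · exact op_comm_of_le' e c i fun d hd => le_trans hj (hk d hd)
      · exact hj.elim
    by_cases hi : IsLE i k
    · rcases i with b | b
      · have := op_comm_of_le' e c j (k := b) (N := M) fun d hd => le_trans hi (hk d hd)
        rw [← lie_skew, map_neg, LinearMap.neg_apply, ← this, neg_sub]
      · exact hi.elim
    obtain ⟨N, rfl⟩ := Multiset.exists_cons_of_mem hkM
    have hkN : ∀ b ∈ N, k ≤ b := fun b hb => hk b (Multiset.mem_cons_of_mem hb)
    have hN : N.card ≤ n := by rw [Multiset.card_cons] at hM; omega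
    have hNm : mon R N ∈ degLE R ι n := mon_mem hN
    -- the first operator moves past the leading factor
    have key : ∀ i j : ι ⊕ κ, ¬ IsLE i k → ¬ IsLE j k →
        op e c i (op e c j (mon R (k ::ₘ N))) =
          op e c (.inl k) (op e c i (op e c j (mon R N))) +
            act e c ⁅e i, e (.inl k)⁆ (op e c j (mon R N)) +
            op e c i (act e c ⁅e j, e (.inl k)⁆ (mon R N)) := by
      intro i j hi hj
      rw [op_cons e c hkN hj, map_add]
      congr 1
      -- The top term of e_j N is too long for the induction hypothesis, but k is still at most all
      -- its factors, so `op_comm_of_le` applies; the lower part is covered by induction.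
      rw [op_mon e c j N, map_add, map_add, map_add, map_add, map_add]
      have h1 := hcomm (e i) (e (.inl k)) (degLE_mono hN (low_mem e c j N))
      have h2 : op e c i (op e c (.inl k) (lead R j (mon R N))) =
          op e c (.inl k) (op e c i (lead R j (mon R N))) +
            act e c ⁅e i, e (.inl k)⁆ (lead R j (mon R N)) := by
        rcases j with b | b
        · rw [lead_inl, ← sub_eq_iff_eq_add']
          refine op_comm_of_le e c (fun d hd => ?_) hi
          rcases Multiset.mem_cons.1 hd with rfl | hd
          · exact (not_le.1 hj).le
          · exact hkN d hd
        · simp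
      simp only [act_basis, sub_eq_iff_eq_add'] at h1
      rw [h2, h1]
      abel
    have h1 := hcomm ⁅e i, e (.inl k)⁆ (e j) hNm
    have h2 := hcomm (e i) ⁅e j, e (.inl k)⁆ hNm
    have h3 := hcomm (e i) (e j) hNm
    have h4 := hcomm (e (.inl k)) ⁅e i, e j⁆ hNm
    simp only [act_basis] at h1 h2 h3 h4
    have hjac : ⁅e i, ⁅e j, e (.inl k)⁆⁆ = ⁅⁅e i, e j⁆, e (.inl k)⁆ + ⁅e j, ⁅e i, e (.inl k)⁆⁆ :=
      leibniz_lie _ _ _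
    have hk0 : mon R (k ::ₘ N) = op e c (.inl k) (mon R N) := (op_inl_of_le e c hkN).symm
    have h5 := congrArg (op e c (.inl k)) h3
    have h6 : act e c ⁅e i, ⁅e j, e (.inl k)⁆⁆ (mon R N) +
        act e c ⁅⁅e i, e (.inl k)⁆, e j⁆ (mon R N) +
        act e c ⁅e (.inl k), ⁅e i, e j⁆⁆ (mon R N) = 0 := by
      rw [← LinearMap.add_apply, ← LinearMap.add_apply, ← map_add, ← map_add, hjac,
        ← lie_skew (e j), ← lie_skew (e (.inl k))]
      simp only [lie_lie, neg_sub, map_sub, map_add, LinearMap.add_apply,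
        LinearMap.sub_apply]
      abel
    rw [map_sub] at h5
    rw [key i j hi hj, key j i hj hi, hk0]
    linear_combination (norm := abel) h1 + h2 + h5 + h4 + h6

theorem act_subalgebra {h : LieSubalgebra K L} {lam : L →ₗ[K] R} (f : Basis κ K h)
    (he : ∀ a, e (.inr a) = f a) {x : L} (hx : x ∈ h) :
    act e (fun a => lam (e (.inr a))) x (mon R 0) = lam x • mon R 0 := by
  have hx' : (⟨x, hx⟩ : h) ∈ Submodule.span K (Set.range f) := by
    rw [f.span_eq]; trivial
  generalize hy : (⟨x, hx⟩ : h) = y at hx'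
  obtain rfl : x = y := congrArg Subtype.val hy
  clear hy hx
  induction hx' using Submodule.span_induction with
  | zero => simp
  | add u w _ _ hu hw =>
    change act e _ ((u : L) + w) _ = _
    rw [map_add, AddMemClass.coe_add, map_add, LinearMap.add_apply, hu, hw, add_smul]
  | smul t u _ hu =>
    change act e _ (t • (u : L)) _ = lam (t • (u : L)) • _
    rw [map_smul, map_smul, LinearMap.smul_apply, hu, smul_assoc]
  | mem u hu =>
    obtain ⟨a, rfl⟩ := hu
    rw [← he, act_basis, op_inr_zero]

/-- For a subalgebra `h` and a linear form `lam` which vanishes on the brackets of `h`, there is a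
representation on a free module in which `h` acts on a basis vector through `lam`. -/
theorem exists_representation (h : LieSubalgebra K L) (lam : L →ₗ[K] R)
    (hlam : ∀ x ∈ h, ∀ y ∈ h, lam ⁅x, y⁆ = 0) :
    ∃ (C : Submodule K L) (s : Set C) (ρ : L →ₗ⁅K⁆ Module.End R (Multiset s →₀ R)),
      ∀ x ∈ h, ρ x (Finsupp.single 0 1) = lam x • Finsupp.single 0 1 := by
  classical
  obtain ⟨C, hC⟩ := Submodule.exists_isCompl h.toSubmodule
  obtain ⟨s, ⟨f'⟩⟩ : ∃ s : Set C, Nonempty (Basis s K C) := ⟨_, ⟨Basis.ofVectorSpace K C⟩⟩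
  obtain ⟨t, ⟨f⟩⟩ : ∃ t : Set h, Nonempty (Basis t K h) := ⟨_, ⟨Basis.ofVectorSpace K h⟩⟩
  obtain ⟨e, he⟩ : ∃ e : Basis (s ⊕ t) K L, ∀ a, e (.inr a) = f a :=
    ⟨(f'.prod f).map (Submodule.prodEquivOfIsCompl C h.toSubmodule hC.symm), fun a => by
      simp only [Basis.map_apply, Basis.prod_apply, LinearMap.coe_inl, LinearMap.coe_inr,
        Sum.elim_inr, Function.comp_apply]
      exact (Submodule.coe_prodEquivOfIsCompl' C h.toSubmodule hC.symm (0, f a)).trans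
        (zero_add _)⟩
  -- Only minima of finite multisets are taken, so any linear order would do.
  let _ : LinearOrder s := linearOrderOfSTO WellOrderingRel
  have hact := fun (x : L) (hx : x ∈ h) => act_subalgebra (R := R) (lam := lam) f he hx
  have hmem : ∀ a, e (.inr a) ∈ h := fun a => by rw [he]; exact (f a).2
  refine ⟨C, s, { act e (fun a => lam (e (.inr a))) with map_lie' := ?_ }, hact⟩
  intro u w
  refine Finsupp.lhom_ext' fun M => LinearMap.ext_ring ?_
  refine (act_comm_extend e _ (f := mon R M) (fun i j => op_comm ?_ M.card i j le_rfl) u w).symm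
  intro a b
  rw [hact _ (h.lie_mem (hmem a) (hmem b)), hlam _ (hmem a) _ (hmem b), zero_smul]

end Induced
open Module

/-! ### The weight filtration on a Whittaker module -/

section Filtration

variable {Q : Type*} [AddCommGroup Q] [LinearOrder Q] [IsOrderedAddMonoid Q]
  {g : Type*} [LieRing g] [LieAlgebra ℂ g] {G : Q → Submodule ℂ g} [GradedLieAlgebra G]
  {π : Q →+o ℤ} {x : Q → g} {P : Set Q} {a : Q} {ψ : g →ₗ[ℂ] ℂ}
  {B : Type*} [CommRing B] [Algebra ℂ B]
  {V : Type*} [AddCommGroup V] [Module ℂ V] [Module B V] [IsScalarTower ℂ B V]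
  {ρ : g →ₗ⁅ℂ⁆ End B V} {v : V}

/-- A graded Lie algebra acting `B`-linearly on a module with a Whittaker vector `v`: the part of
nonpositive degree is spanned by the `x β` with `β ∈ P` modulo elements acting as scalars, the
character `ψ` has highest degree `a`, and it pairs each `x β` with an element of degree `a - β`. -/
structure WhittakerData (G : Q → Submodule ℂ g) (π : Q →+o ℤ) (x : Q → g) (P : Set Q) (a : Q)
    (ψ : g →ₗ[ℂ] ℂ) (ρ : g →ₗ⁅ℂ⁆ End B V) (v : V) : Prop where
  nonpos : ∀ b ∈ P, π b ≤ 0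
  mem : ∀ b ∈ P, x b ∈ G b
  pos : 0 < π a
  exists_eq : ∀ c, π c ≤ 0 → ∀ u ∈ G c, ∃ z : g, ∃ t : ℂ, u = t • x c + z ∧ (t = 0 ∨ c ∈ P) ∧
    ∃ b : B, ∀ m : V, ρ z m = b • m
  apply_eq_zero : ∀ c, a < c → ∀ u ∈ G c, ψ u = 0
  nonsingular : ∀ b ∈ P, ∃ y ∈ G (a - b), ψ ⁅y, x b⁆ ≠ 0
  vector : ∀ c, 0 < π c → ∀ u ∈ G c, ρ u v = ψ u • v

/-- The vector obtained from `v` by applying the elements `x β` for the entries `β` of a list. -/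
def word (x : Q → g) (ρ : g →ₗ⁅ℂ⁆ End B V) (v : V) (l : List P) : V :=
  l.foldr (fun b m => ρ (x b) m) v

@[simp] theorem word_nil : word x ρ v ([] : List P) = v := rfl

@[simp] theorem word_cons (b : P) (l : List P) :
    word x ρ v (b :: l) = ρ (x b) (word x ρ v l) := rfl

/-- The span of the words in a set of lists. -/
def wordSpan (x : Q → g) (ρ : g →ₗ⁅ℂ⁆ End B V) (v : V) (S : Set (List P)) : Submodule B V :=
  Submodule.span B (word x ρ v '' S)

theorem word_mem {S : Set (List P)} {l : List P} (h : l ∈ S) :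
    word x ρ v l ∈ wordSpan x ρ v S :=
  Submodule.subset_span ⟨l, h, rfl⟩

theorem wordSpan_mono {S T : Set (List P)} (h : S ⊆ T) : wordSpan x ρ v S ≤ wordSpan x ρ v T :=
  Submodule.span_mono (Set.image_mono h)

theorem wordSpan_map {S T : Set (List P)} {f : End B V}
    (h : ∀ l ∈ S, f (word x ρ v l) ∈ wordSpan x ρ v T) {m : V} (hm : m ∈ wordSpan x ρ v S) :
    f m ∈ wordSpan x ρ v T := by
  have : wordSpan x ρ v S ≤ (wordSpan x ρ v T).comap f := by
    rw [wordSpan, Submodule.span_le]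
    rintro _ ⟨l, hl, rfl⟩
    exact h l hl
  exact this hm

theorem rho_lie (u w : g) (m : V) : ρ ⁅u, w⁆ m = ρ u (ρ w m) - ρ w (ρ u m) := by
  rw [LieHom.map_lie, LieRing.of_associative_ring_bracket]
  rfl

theorem rho_comm (u w : g) (m : V) : ρ u (ρ w m) = ρ w (ρ u m) + ρ ⁅u, w⁆ m := by
  rw [rho_lie]; abel

/-- The weight of a monomial: `x β` has weight `a - β`. -/
def weight (a : Q) (I : Multiset P) : Q := (I.map fun b => a - (b : Q)).sum

@[simp] theorem weight_zero : weight a (0 : Multiset P) = 0 := rfl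

@[simp] theorem weight_nil : weight a (([] : List P) : Multiset P) = 0 := rfl

@[simp] theorem weight_cons (b : P) (I : Multiset P) :
    weight a (b ::ₘ I) = a - b + weight a I := by
  simp [weight]

@[simp] theorem weight_coe_cons (b : P) (l : List P) :
    weight a ((b :: l : List P) : Multiset P) = a - b + weight a (l : Multiset P) := by
  rw [← Multiset.cons_coe, weight_cons]

/-- The span of the words of weight at most `w`. -/
abbrev filLE (x : Q → g) (P : Set Q) (a : Q) (ρ : g →ₗ⁅ℂ⁆ End B V) (v : V) (w : Q) :
    Submodule B V :=
  wordSpan x ρ v {l : List P | weight a (l : Multiset P) ≤ w}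

/-- The span of the words of weight less than `w`. -/
abbrev filLT (x : Q → g) (P : Set Q) (a : Q) (ρ : g →ₗ⁅ℂ⁆ End B V) (v : V) (w : Q) :
    Submodule B V :=
  wordSpan x ρ v {l : List P | weight a (l : Multiset P) < w}

theorem filLE_mono {w w' : Q} (h : w ≤ w') : filLE x P a ρ v w ≤ filLE x P a ρ v w' :=
  wordSpan_mono fun _ hl => le_trans hl h

theorem filLE_le_filLT {w w' : Q} (h : w < w') : filLE x P a ρ v w ≤ filLT x P a ρ v w' :=
  wordSpan_mono fun _ hl => lt_of_le_of_lt hl h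

theorem filLE_map {f : End B V} {c : Q} (h : ∀ l : List P,
    f (word x ρ v l) ∈ filLE x P a ρ v (weight a (l : Multiset P) + c)) {w : Q} {m : V}
    (hm : m ∈ filLE x P a ρ v w) : f m ∈ filLE x P a ρ v (w + c) := by
  refine wordSpan_map (fun l hl => ?_) hm
  have hl' : weight a (l : Multiset P) ≤ w := hl
  exact filLE_mono (add_le_add hl' le_rfl) (h l)

theorem filLT_map {f : End B V} {c : Q} (h : ∀ l : List P,
    f (word x ρ v l) ∈ filLE x P a ρ v (weight a (l : Multiset P) + c)) {w : Q} {m : V}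
    (hm : m ∈ filLT x P a ρ v w) : f m ∈ filLT x P a ρ v (w + c) := by
  refine wordSpan_map (fun l hl => ?_) hm
  have hl' : weight a (l : Multiset P) < w := hl
  exact filLE_le_filLT (add_lt_add_of_lt_of_le hl' le_rfl) (h l)

theorem rho_x_map (b : P) (l : List P) :
    ρ (x b) (word x ρ v l) ∈ filLE x P a ρ v (weight a (l : Multiset P) + (a - b)) := by
  rw [← word_cons]
  refine word_mem ?_
  simp [add_comm]

namespace WhittakerData

variable (D : WhittakerData G π x P a ψ ρ v)
include D

theorem a_pos : 0 < a := by
  by_contra h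
  have := OrderHomClass.mono π (not_lt.1 h)
  have := D.pos
  simp at *
  omega

theorem lt_a {b : Q} (hb : π b ≤ 0) : b < a := by
  by_contra h
  have := OrderHomClass.mono π (not_lt.1 h)
  have := D.pos
  omega

theorem lt_a' (b : P) : (b : Q) < a := D.lt_a (D.nonpos b b.2)

theorem weight_nonneg (I : Multiset P) : 0 ≤ weight a I := by
  induction I using Multiset.induction_on with
  | empty => simp
  | cons b I ih =>
    rw [weight_cons]
    exact add_nonneg (sub_nonneg.2 (D.lt_a' b).le) ih

theorem apply_word_of_nonpos {c : Q} (hc : π c ≤ 0) {u : g} (hu : u ∈ G c) (l : List P) :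
    ρ u (word x ρ v l) ∈ filLE x P a ρ v (weight a (l : Multiset P) + (a - c)) := by
  obtain ⟨z, t, rfl, ht, b, hb⟩ := D.exists_eq c hc u hu
  rw [map_add, LinearMap.add_apply, hb]
  refine Submodule.add_mem _ ?_ (Submodule.smul_mem _ _ (word_mem ?_))
  · rcases ht with rfl | hc
    · simp
    · rw [map_smul, LinearMap.smul_apply]
      exact Submodule.smul_of_tower_mem _ _ (rho_x_map ⟨c, hc⟩ l)
  · exact le_add_of_nonneg_right (sub_nonneg.2 (D.lt_a hc).le)

theorem smul_word_mem {c : Q} {u : g} (hu : u ∈ G c) (l : List P) :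
    ψ u • word x ρ v l ∈ filLE x P a ρ v (weight a (l : Multiset P) + (a - c)) := by
  rcases lt_or_ge a c with h | h
  · rw [D.apply_eq_zero c h u hu, zero_smul]
    exact Submodule.zero_mem _
  · exact Submodule.smul_of_tower_mem _ _ (word_mem (le_add_of_nonneg_right (sub_nonneg.2 h)))

/-- Moving u past x_b leaves [u, x_b], of degree c + b, which raises weight by at most a - (c + b);
this is the weight of x_b lowered by c. When c + b is positive in π, the scalar ψ([u, x_b]) fits
this bound because it vanishes for c + b > a. -/
theorem apply_word_of_pos {c : Q} (hc : 0 < π c) {u : g} (hu : u ∈ G c) (l : List P) :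
    ρ u (word x ρ v l) - ψ u • word x ρ v l ∈
      filLE x P a ρ v (weight a (l : Multiset P) + -c) := by
  induction l generalizing c u with
  | nil => simp [D.vector c hc u hu]
  | cons b l ih =>
    have hb : ⁅u, x b⁆ ∈ G (c + b) := SetLike.GradedBracket.bracket_mem hu (D.mem b b.2)
    have h1 := filLE_map (rho_x_map b) (ih hc hu)
    have h2 : ρ ⁅u, x b⁆ (word x ρ v l) ∈
        filLE x P a ρ v (weight a (l : Multiset P) + (a - (c + b))) := by
      rcases le_or_gt (π (c + b)) 0 with h | h
      · exact D.apply_word_of_nonpos h hb l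
      · have := Submodule.add_mem _ (filLE_mono ?_ (ih h hb)) (D.smul_word_mem hb l)
        · rwa [sub_add_cancel] at this
        · rw [sub_eq_add_neg]
          exact add_le_add_right (le_add_of_nonneg_left D.a_pos.le) _
    rw [word_cons, rho_comm u (x b), weight_coe_cons]
    have h3 : ρ (x b) (ρ u (word x ρ v l)) + ρ ⁅u, x b⁆ (word x ρ v l) -
        ψ u • ρ (x b) (word x ρ v l) =
        ρ (x b) (ρ u (word x ρ v l) - ψ u • word x ρ v l) + ρ ⁅u, x b⁆ (word x ρ v l) := by
      rw [map_sub, LinearMap.map_smul_of_tower]; abel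
    rw [h3]
    refine Submodule.add_mem _ (filLE_mono (le_of_eq ?_) h1) (filLE_mono (le_of_eq ?_) h2)
    · abel
    · abel

theorem apply_word {c : Q} {u : g} (hu : u ∈ G c) (l : List P) :
    ρ u (word x ρ v l) ∈ filLE x P a ρ v (weight a (l : Multiset P) + (a - c)) := by
  rcases le_or_gt (π c) 0 with h | h
  · exact D.apply_word_of_nonpos h hu l
  · have := Submodule.add_mem _ (filLE_mono ?_ (D.apply_word_of_pos h hu l)) (D.smul_word_mem hu l)
    · rwa [sub_add_cancel] at this
    · rw [sub_eq_add_neg]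
      exact add_le_add_right (le_add_of_nonneg_left D.a_pos.le) _

/-- The bracket [x_c, x_b] raises weight by at most a - (c + b), which is less than (a - c) + (a -
b) because a > 0. -/
theorem word_perm {l l' : List P} (h : l.Perm l') :
    word x ρ v l - word x ρ v l' ∈ filLT x P a ρ v (weight a (l : Multiset P)) := by
  induction h with
  | nil => simp
  | cons b _ ih =>
    have := filLT_map (rho_x_map b) ih
    rw [map_sub] at this
    rwa [weight_coe_cons, add_comm]
  | swap b c l =>
    have hb : ⁅x c, x b⁆ ∈ G (c + b : Q) :=
      SetLike.GradedBracket.bracket_mem (D.mem c c.2) (D.mem b b.2)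
    simp only [word_cons, weight_coe_cons]
    rw [← rho_lie]
    refine filLE_le_filLT ?_ (D.apply_word hb l)
    rw [← sub_pos]
    convert D.a_pos using 1
    abel
  | trans h₁ _ ih₁ ih₂ =>
    rw [← sub_add_sub_cancel]
    rw [← Multiset.coe_eq_coe.2 h₁] at ih₂
    exact Submodule.add_mem _ ih₁ ih₂

/-- For c ≥ b the bracket [y, x_c] has degree a - b + c ≥ a. Its scalar ψ([y, x_c]) is zero for c >
b, so only the factors equal to b contribute, once each; its remaining action drops a further weight
a. Minimality of b is what makes y act as a derivation in x_b alone. -/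
theorem apply_word_leading {b : P} {y : g} (hy : y ∈ G (a - b)) {l : List P}
    (hl : ∀ c ∈ l, b ≤ c) :
    ρ y (word x ρ v l) - ψ y • word x ρ v l -
      (ψ ⁅y, x b⁆ * l.count b) • word x ρ v (l.erase b) ∈
        filLT x P a ρ v (weight a (l : Multiset P) + -(a - b)) := by
  have hpos : 0 < π (a - b) := by
    have h1 := D.pos
    have h2 := D.nonpos b b.2
    rw [map_sub]; omega
  induction l with
  | nil => simp [D.vector _ hpos y hy]
  | cons c l ih =>
    replace ih := filLT_map (rho_x_map c) (ih fun d hd => hl d (List.mem_cons_of_mem _ hd))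
    rw [word_cons, rho_comm y (x c), weight_coe_cons]
    have hw : weight a (l : Multiset P) + -(a - b) + (a - c) =
      a - c + weight a (l : Multiset P) + -(a - b) := by abel
    rw [hw] at ih
    have hu : ⁅y, x c⁆ ∈ G (a - b + c) :=
      SetLike.GradedBracket.bracket_mem hy (D.mem c c.2)
    have hbc : (b : Q) ≤ c := hl c List.mem_cons_self
    have hpos' : 0 < π (a - b + c) := by
      have h1 := D.pos
      have h2 := OrderHomClass.mono π hbc
      rw [map_add, map_sub]
      omega
    have h1 := filLE_le_filLT (w' := a - c + weight a (l : Multiset P) + -(a - b)) (by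
      rw [← sub_pos]
      convert D.a_pos using 1
      abel) (D.apply_word_of_pos hpos' hu l)
    rcases eq_or_ne c b with rfl | hcb
    · have h2 : ((ψ ⁅y, x c⁆ * l.count c) • (ρ (x c) (word x ρ v (l.erase c)) - word x ρ v l)) ∈
          filLT x P a ρ v (a - c + weight a (l : Multiset P) + -(a - c)) := by
        by_cases hcl : c ∈ l
        · have := neg_mem (D.word_perm (List.perm_cons_erase hcl))
          rw [neg_sub, word_cons] at this
          refine Submodule.smul_of_tower_mem _ _ ?_
          convert this using 2
          abel
        · simp [List.count_eq_zero_of_not_mem hcl]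
      convert Submodule.add_mem _ (Submodule.add_mem _ ih h1) h2 using 1
      rw [List.erase_cons_head, List.count_cons_self]
      simp only [map_sub, LinearMap.map_smul_of_tower, smul_sub, Nat.cast_succ, mul_add, add_smul,
        mul_one]
      abel
    · have hlt : (b : Q) < c := lt_of_le_of_ne hbc fun h => hcb (Subtype.ext h.symm)
      have h0 : ψ ⁅y, x c⁆ = 0 := D.apply_eq_zero _ (by
        rw [← sub_pos]
        convert sub_pos.2 hlt using 1
        abel) _ hu
      rw [h0, zero_smul, sub_zero] at h1
      convert Submodule.add_mem _ ih h1 using 1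
      rw [List.erase_cons_tail (by simpa using fun h => hcb (Subtype.ext h)), List.count_cons_of_ne hcb]
      simp only [map_sub, LinearMap.map_smul_of_tower, word_cons]
      abel

end WhittakerData

/-! ### Differentiating leading terms -/

theorem count_toList {α : Type*} [BEq α] [LawfulBEq α] [DecidableEq α] (b : α) (I : Multiset α) :
    I.toList.count b = I.count b := by
  obtain rfl : ‹BEq α› = instBEqOfDecidableEq := lawful_beq_subsingleton _ _
  conv_rhs => rw [← Multiset.coe_toList I, Multiset.coe_count]

theorem coe_erase_toList {α : Type*} [BEq α] [LawfulBEq α] [DecidableEq α] (b : α)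
    (I : Multiset α) : ((I.toList.erase b : List α) : Multiset α) = I.erase b := by
  obtain rfl : ‹BEq α› = instBEqOfDecidableEq := lawful_beq_subsingleton _ _
  rw [← Multiset.coe_erase, Multiset.coe_toList]

/-- The linear map sending a monomial to the corresponding product of the `x β` applied to `v`. -/
def theta (x : Q → g) (P : Set Q) (ρ : g →ₗ⁅ℂ⁆ End B V) (v : V) : (Multiset P →₀ B) →ₗ[B] V :=
  Finsupp.linearCombination B fun I => word x ρ v I.toList

/-- The operation `t ∂/∂x_b` on polynomials. -/
def derivAt (b : P) (t : ℂ) (c : Multiset P →₀ B) : Multiset P →₀ B :=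
  c.sum fun I r => Finsupp.single (I.erase b) ((t * I.count b) • r)

/-- No cancellation occurs: erasing b is injective on the multisets containing b, and the others
carry multiplicity zero. -/
theorem derivAt_apply_erase {b : P} {t : ℂ} {c : Multiset P →₀ B} {I : Multiset P} (hI : b ∈ I) :
    derivAt b t c (I.erase b) = (t * I.count b) • c I := by
  rw [derivAt, Finsupp.sum, Finsupp.finsetSum_apply, Finset.sum_eq_single I]
  · rw [Finsupp.single_eq_same]
  · intro J _ hJ
    by_cases hb : b ∈ J
    · rw [Finsupp.single_apply, if_neg]
      intro h
      rw [← Multiset.cons_erase hI, ← Multiset.cons_erase hb, h] at hJ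
      exact hJ rfl
    · simp [Multiset.count_eq_zero_of_notMem hb]
  · intro h
    simp [Finsupp.notMem_support_iff.1 h]

theorem exists_of_mem_support_derivAt {b : P} {t : ℂ} {c : Multiset P →₀ B} {J : Multiset P}
    (hJ : J ∈ (derivAt b t c).support) : b ::ₘ J ∈ c.support := by
  by_contra h
  refine (Finsupp.mem_support_iff.1 hJ) ?_
  have := derivAt_apply_erase (t := t) (c := c) (Multiset.mem_cons_self b J)
  rwa [Multiset.erase_cons_head, Finsupp.notMem_support_iff.1 h, smul_zero] at this

namespace WhittakerData

variable (D : WhittakerData G π x P a ψ ρ v)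
include D

theorem theta_mem_filLT {w : Q} {c : Multiset P →₀ B} (hc : ∀ I ∈ c.support, weight a I < w) :
    theta x P ρ v c ∈ filLT x P a ρ v w := by
  rw [theta, Finsupp.linearCombination_apply]
  refine Submodule.sum_mem _ fun I hI => Submodule.smul_mem _ _ (word_mem ?_)
  change weight a (I.toList : Multiset P) < w
  rw [Multiset.coe_toList]
  exact hc I hI

theorem apply_theta_leading {b : P} {y : g} (hy : y ∈ G (a - b)) {w : Q} {c : Multiset P →₀ B}
    (hc : ∀ I ∈ c.support, weight a I = w) (hb : ∀ I ∈ c.support, ∀ d ∈ I, b ≤ d) :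
    ρ y (theta x P ρ v c) - ψ y • theta x P ρ v c - theta x P ρ v (derivAt b (ψ ⁅y, x b⁆) c) ∈
      filLT x P a ρ v (w + -(a - b)) := by
  have h : ρ y (theta x P ρ v c) - ψ y • theta x P ρ v c -
      theta x P ρ v (derivAt b (ψ ⁅y, x b⁆) c) =
      c.sum fun I r => r • (ρ y (word x ρ v I.toList) - ψ y • word x ρ v I.toList -
        (ψ ⁅y, x b⁆ * I.toList.count b) • word x ρ v (I.toList.erase b)) +
        r • (ψ ⁅y, x b⁆ * I.count b) • (word x ρ v (I.toList.erase b) -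
          word x ρ v (I.erase b).toList) := by
    have hd : theta x P ρ v (derivAt b (ψ ⁅y, x b⁆) c) = c.sum fun I r =>
        ((ψ ⁅y, x b⁆ * I.count b) • r) • word x ρ v (I.erase b).toList := by
      rw [derivAt, Finsupp.sum, map_sum]
      simp only [theta, Finsupp.linearCombination_single]
      rfl
    rw [hd, theta, Finsupp.linearCombination_apply]
    simp only [Finsupp.sum, map_sum, Finset.smul_sum]
    rw [← Finset.sum_sub_distrib, ← Finset.sum_sub_distrib]
    refine Finset.sum_congr rfl fun I _ => ?_
    rw [count_toList]
    simp only [map_smul, smul_sub, smul_assoc, smul_comm (c I)]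
    abel
  rw [h]
  refine Submodule.sum_mem _ fun I hI => Submodule.add_mem _ (Submodule.smul_mem _ _ ?_)
    (Submodule.smul_mem _ _ ?_)
  · have := D.apply_word_leading hy (l := I.toList) fun d hd => hb I hI d (by simpa using hd)
    rwa [Multiset.coe_toList, hc I hI] at this
  · by_cases hbI : b ∈ I
    · refine Submodule.smul_of_tower_mem _ _ ?_
      have := D.word_perm (l := I.toList.erase b) (l' := (I.erase b).toList) (by
        rw [← Multiset.coe_eq_coe, Multiset.coe_toList, coe_erase_toList])
      convert this using 2
      rw [coe_erase_toList, ← hc I hI]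
      conv_lhs => rw [← Multiset.cons_erase hbI, weight_cons]
      abel
    · simp [Multiset.count_eq_zero_of_notMem hbI]

theorem filLT_zero : filLT x P a ρ v 0 = ⊥ := by
  have : {l : List P | weight a (l : Multiset P) < 0} = ∅ :=
    Set.eq_empty_of_forall_notMem fun l hl => not_lt.2 (D.weight_nonneg l) hl
  rw [filLT, wordSpan, this, Set.image_empty, Submodule.span_empty]

/-- Here `c` is the leading part and `r` an error of lower weight. Each differentiation lowers the
polynomial degree, so the induction runs on degree; weights need not be well ordered. -/
theorem exists_smul_mem_of_leading {W : Submodule B V} (hW : ∀ u : g, ∀ m ∈ W, ρ u m ∈ W) (n : ℕ)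
    {w : Q} {c : Multiset P →₀ B} {r : V} (hcw : ∀ I ∈ c.support, weight a I = w)
    (hcn : ∀ I ∈ c.support, I.card ≤ n) (hc : c ≠ 0) (hr : r ∈ filLT x P a ρ v w)
    (hm : theta x P ρ v c + r ∈ W) : ∃ b : B, b ≠ 0 ∧ b • v ∈ W := by
  induction n generalizing w c r with
  | zero =>
    have hc0 : c = Finsupp.single 0 (c 0) := by
      rw [← Finsupp.support_subset_singleton]
      intro I hI
      simpa using hcn I hI
    have hc0' : c 0 ≠ 0 := fun h => hc (by rw [hc0, h, Finsupp.single_zero])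
    -- A nonzero constant has weight 0, and no word has negative weight, so the error term vanishes.
    obtain rfl : 0 = w := hcw 0 (Finsupp.mem_support_iff.2 hc0')
    rw [D.filLT_zero, Submodule.mem_bot] at hr
    rw [hr, add_zero, hc0, theta, Finsupp.linearCombination_single, Multiset.toList_zero,
      word_nil] at hm
    exact ⟨_, hc0', hm⟩
  | succ n ih =>
    by_cases hall : ∀ I ∈ c.support, I.card ≤ n
    · exact ih hcw hall hc hr hm
    classical
    push Not at hall
    obtain ⟨I₀, hI₀, hcard⟩ := hall
    obtain ⟨d₀, hd₀⟩ := Multiset.card_pos_iff_exists_mem.1 (Nat.zero_lt_of_lt hcard)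
    -- The variable to differentiate by is the smallest one occurring anywhere in `c`, as the
    -- leading-term formula requires.
    let s := c.support.biUnion Multiset.toFinset
    have hs : ∀ d, d ∈ s ↔ ∃ I ∈ c.support, d ∈ I := by simp [s]
    obtain ⟨b, hb, hmin⟩ := s.exists_min_image id ⟨d₀, (hs d₀).2 ⟨I₀, hI₀, hd₀⟩⟩
    obtain ⟨I, hI, hbI⟩ := (hs b).1 hb
    obtain ⟨y, hy, hne⟩ := D.nonsingular b b.2
    have hpos : 0 < π (a - b) := by
      have h1 := D.pos
      have h2 := D.nonpos b b.2
      rw [map_sub]; omega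
    have hsupp := fun J => exists_of_mem_support_derivAt (b := b) (t := ψ ⁅y, x b⁆) (c := c) (J := J)
    have h1 := D.apply_theta_leading hy hcw fun I hI d hd => hmin d ((hs d).2 ⟨I, hI, hd⟩)
    have h2 : ρ y r - ψ y • r ∈ filLT x P a ρ v (w + -(a - b)) :=
      filLT_map (f := ρ y - ψ y • (LinearMap.id : End B V)) (fun l => D.apply_word_of_pos hpos hy l)
        hr
    refine ih (c := derivAt b (ψ ⁅y, x b⁆) c) (w := w + -(a - b)) ?_ ?_ ?_
      (Submodule.add_mem _ h1 h2) ?_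
    · intro J hJ
      rw [← hcw _ (hsupp J hJ), weight_cons]
      abel
    · intro J hJ
      have := hcn _ (hsupp J hJ)
      rw [Multiset.card_cons] at this
      omega
    · intro h
      have h3 := derivAt_apply_erase (t := ψ ⁅y, x b⁆) (c := c) hbI
      rw [h, Finsupp.zero_apply] at h3
      -- The factor is a nonzero complex number, so it cancels although `B` need not be a domain.
      have h4 : ψ ⁅y, x b⁆ * (I.count b : ℂ) ≠ 0 :=
        mul_ne_zero hne (Nat.cast_ne_zero.2 (Multiset.count_ne_zero.2 hbI))
      exact (Finsupp.mem_support_iff.1 hI) ((smul_eq_zero_iff_right h4).1 h3.symm)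
    · convert Submodule.sub_mem _ (hW y _ hm) (Submodule.smul_of_tower_mem W (ψ y) hm) using 1
      simp only [map_add, smul_add]
      abel

/-- A stable submodule containing a nonzero polynomial expression in the `x β` applied to `v`
contains a nonzero multiple of `v`. -/
theorem exists_smul_mem {W : Submodule B V} (hW : ∀ u : g, ∀ m ∈ W, ρ u m ∈ W)
    {c : Multiset P →₀ B} (hc : c ≠ 0) (hm : theta x P ρ v c ∈ W) :
    ∃ b : B, b ≠ 0 ∧ b • v ∈ W := by
  classical
  -- The polynomial is split into its part of highest weight and a remainder of lower weight.
  obtain ⟨I, hI, hmax⟩ := c.support.exists_max_image (weight a) (Finsupp.support_nonempty_iff.2 hc)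
  have hsplit := c.filter_add_filter_not (fun J => weight a J = weight a I)
  refine D.exists_smul_mem_of_leading hW (c.support.sup Multiset.card)
    (c := c.filter fun J => weight a J = weight a I) (w := weight a I)
    (r := theta x P ρ v (c.filter fun J => ¬ weight a J = weight a I)) ?_ ?_ ?_ ?_ ?_
  · intro J hJ
    rw [Finsupp.support_filter, Finset.mem_filter] at hJ
    exact hJ.2
  · intro J hJ
    rw [Finsupp.support_filter, Finset.mem_filter] at hJ
    exact Finset.le_sup (f := Multiset.card) hJ.1
  · intro h
    have := DFunLike.congr_fun h I
    rw [Finsupp.filter_apply_pos (fun J => weight a J = weight a I) c rfl] at this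
    exact Finsupp.mem_support_iff.1 hI this
  · refine D.theta_mem_filLT fun J hJ => ?_
    rw [Finsupp.support_filter, Finset.mem_filter] at hJ
    exact lt_of_le_of_ne (hmax J hJ.1) hJ.2
  · rwa [← map_add, hsplit]

theorem theta_injective (hv : ∀ b : B, b • v = 0 → b = 0) :
    Function.Injective (theta x P ρ v) := by
  rw [injective_iff_map_eq_zero]
  intro c hc
  by_contra h
  obtain ⟨b, hb, hbv⟩ := D.exists_smul_mem (W := ⊥) (by simp) h (by simpa using hc)
  exact hb (hv b (by simpa using hbv))

/-- Spanning is proved by word length, since descent along weights need not terminate. An element of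
nonpositive degree adds at most one letter, so the bracket of two letters yields words shorter than
their product. -/
theorem apply_word_length {c : Q} (hc : π c ≤ 0) {u : g} (hu : u ∈ G c) (l : List P) :
    ρ u (word x ρ v l) ∈ wordSpan x ρ v {l' : List P | l'.length < l.length + 2} := by
  obtain ⟨z, t, rfl, ht, b, hb⟩ := D.exists_eq c hc u hu
  rw [map_add, LinearMap.add_apply, hb]
  refine Submodule.add_mem _ ?_ (Submodule.smul_mem _ _ (word_mem ?_))
  · rcases ht with rfl | hc
    · simp
    · rw [map_smul, LinearMap.smul_apply]
      refine Submodule.smul_of_tower_mem _ _ (word_mem (l := ⟨c, hc⟩ :: l) ?_)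
      simp
  · simp

theorem word_perm_length {l l' : List P} (h : l.Perm l') :
    word x ρ v l - word x ρ v l' ∈ wordSpan x ρ v {l' : List P | l'.length < l.length} := by
  induction h with
  | nil => simp
  | @cons b l l' _ ih =>
    rw [word_cons, word_cons, ← map_sub]
    refine wordSpan_map (fun l' hl' => ?_) ih
    rw [← word_cons]
    exact word_mem (by simpa using hl')
  | swap b c l =>
    have hb : ⁅x c, x b⁆ ∈ G (c + b : Q) :=
      SetLike.GradedBracket.bracket_mem (D.mem c c.2) (D.mem b b.2)
    simp only [word_cons]
    rw [← rho_lie]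
    refine D.apply_word_length ?_ hb l
    rw [map_add]
    exact add_nonpos (D.nonpos c c.2) (D.nonpos b b.2)
  | trans h₁ _ ih₁ ih₂ =>
    rw [← sub_add_sub_cancel]
    rw [← h₁.length_eq] at ih₂
    exact Submodule.add_mem _ ih₁ ih₂

theorem word_mem_range_theta (l : List P) : word x ρ v l ∈ LinearMap.range (theta x P ρ v) := by
  induction hn : l.length using Nat.strong_induction_on generalizing l with
  | _ n ih =>
    have h1 : word x ρ v (l : Multiset P).toList ∈ LinearMap.range (theta x P ρ v) :=
      ⟨Finsupp.single (l : Multiset P) 1, by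
        rw [theta, Finsupp.linearCombination_single, one_smul]⟩
    have h2 := D.word_perm_length (l := l) (l' := (l : Multiset P).toList)
      (by rw [← Multiset.coe_eq_coe, Multiset.coe_toList])
    have h3 : wordSpan x ρ v {l' : List P | l'.length < l.length} ≤
        LinearMap.range (theta x P ρ v) := by
      rw [wordSpan, Submodule.span_le]
      rintro _ ⟨l', hl', rfl⟩
      exact ih l'.length (hn ▸ hl') l' rfl
    have := Submodule.add_mem _ (h3 h2) h1
    rwa [sub_add_cancel] at this

/-- The span of all words contains v and is stable under every homogeneous element, hence is
everything; reordering letters then brings each word into the range. -/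
theorem theta_surjective
    (hgen : ∀ W : Submodule B V, v ∈ W → (∀ u : g, ∀ m ∈ W, ρ u m ∈ W) → W = ⊤) :
    Function.Surjective (theta x P ρ v) := by
  rw [← LinearMap.range_eq_top, eq_top_iff]
  have h1 : wordSpan x ρ v (Set.univ : Set (List P)) ≤ LinearMap.range (theta x P ρ v) := by
    rw [wordSpan, Submodule.span_le]
    rintro _ ⟨l', -, rfl⟩
    exact D.word_mem_range_theta l'
  rw [← hgen (wordSpan x ρ v (Set.univ : Set (List P))) (word_mem (l := []) trivial) ?_]
  · exact h1
  intro u m hm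
  have hu : u ∈ ⨆ c, G c := by
    rw [(DirectSum.Decomposition.isInternal G).submodule_iSup_eq_top]
    trivial
  induction hu using Submodule.iSup_induction' with
  | zero => simp
  | add u w _ _ hu hw =>
    rw [map_add, LinearMap.add_apply]
    exact Submodule.add_mem _ hu hw
  | mem c u hu =>
    refine wordSpan_map (fun l _ => ?_) hm
    exact wordSpan_mono (Set.subset_univ _) (D.apply_word hu l)

end WhittakerData

end Filtration

/-! ### Actions of U(𝔤) and S(Z''), and the universal property of M_φ -/

section Modules

section Enveloping

variable {L : Type*} [LieRing L] [LieAlgebra ℂ L]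

/-- A subalgebra of the enveloping algebra containing the image of the Lie algebra is everything. -/
theorem mem_of_forall_ι_mem (S : Subalgebra ℂ (UniversalEnvelopingAlgebra ℂ L))
    (hS : ∀ y : L, UniversalEnvelopingAlgebra.ι ℂ y ∈ S) (u : UniversalEnvelopingAlgebra ℂ L) :
    u ∈ S := by
  let f : L →ₗ⁅ℂ⁆ S :=
    { toFun := fun y => ⟨UniversalEnvelopingAlgebra.ι ℂ y, hS y⟩
      map_add' := fun x y => Subtype.ext (map_add _ x y)
      map_smul' := fun t x => Subtype.ext (map_smul _ t x)
      map_lie' := fun {x y} => Subtype.ext (LieHom.map_lie _ x y) }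
  have h : S.val.comp (UniversalEnvelopingAlgebra.lift ℂ f) = AlgHom.id ℂ _ := by
    apply UniversalEnvelopingAlgebra.hom_ext
    ext y
    change ((UniversalEnvelopingAlgebra.lift ℂ f (UniversalEnvelopingAlgebra.ι ℂ y) : S) :
      UniversalEnvelopingAlgebra ℂ L) = UniversalEnvelopingAlgebra.ι ℂ y
    rw [UniversalEnvelopingAlgebra.lift_ι_apply]
    rfl
  have := DFunLike.congr_fun h u
  rw [← show _ = u from this]
  exact (UniversalEnvelopingAlgebra.lift ℂ f u).2

theorem enveloping_induction {p : UniversalEnvelopingAlgebra ℂ L → Prop}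
    (algebraMap : ∀ t : ℂ, p (algebraMap ℂ _ t))
    (ι : ∀ y : L, p (UniversalEnvelopingAlgebra.ι ℂ y))
    (add : ∀ u w, p u → p w → p (u + w)) (mul : ∀ u w, p u → p w → p (u * w))
    (u : UniversalEnvelopingAlgebra ℂ L) : p u :=
  mem_of_forall_ι_mem
    { carrier := {u | p u}
      mul_mem' := fun {u w} hu hw => mul u w hu hw
      add_mem' := fun {u w} hu hw => add u w hu hw
      algebraMap_mem' := algebraMap } ι u

end Enveloping

variable {g : Type*} [LieRing g] [LieAlgebra ℂ g]

section Action

variable (V : Type*) [AddCommGroup V] [Module ℂ V] [LieRingModule g V] [LieModule ℂ g V]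
  {W : Type*} [AddCommGroup W] [Module ℂ W] [LieRingModule g W] [LieModule ℂ g W]

/-- The action of the enveloping algebra on a module. -/
def envAct : UniversalEnvelopingAlgebra ℂ g →ₐ[ℂ] End ℂ V :=
  UniversalEnvelopingAlgebra.lift ℂ (LieModule.toEnd ℂ g V)

variable {V}

@[simp] theorem envAct_ι (u : g) (m : V) :
    envAct V (UniversalEnvelopingAlgebra.ι ℂ u) m = ⁅u, m⁆ := by
  rw [envAct, UniversalEnvelopingAlgebra.lift_ι_apply, LieModule.toEnd_apply_apply]

theorem envAct_mem (N : LieSubmodule ℂ g V) (u : UniversalEnvelopingAlgebra ℂ g) {m : V}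
    (hm : m ∈ N) : envAct V u m ∈ N := by
  induction u using enveloping_induction generalizing m with
  | algebraMap t =>
    rw [AlgHom.commutes, Module.algebraMap_end_apply]
    exact N.smul_mem t hm
  | ι y => rw [envAct_ι]; exact N.lie_mem hm
  | add u w hu hw => rw [map_add, LinearMap.add_apply]; exact N.add_mem (hu hm) (hw hm)
  | mul u w hu hw => rw [map_mul, Module.End.mul_apply]; exact hu (hw hm)

theorem map_envAct (F : V →ₗ⁅ℂ, g⁆ W) (u : UniversalEnvelopingAlgebra ℂ g) (m : V) :
    F (envAct V u m) = envAct W u (F m) := by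
  induction u using enveloping_induction generalizing m with
  | algebraMap t =>
    rw [AlgHom.commutes, AlgHom.commutes, Module.algebraMap_end_apply,
      Module.algebraMap_end_apply, map_smul]
  | ι y => rw [envAct_ι, envAct_ι, LieModuleHom.map_lie]
  | add u w hu hw => simp only [map_add, LinearMap.add_apply, hu, hw]
  | mul u w hu hw => simp only [map_mul, Module.End.mul_apply, hu, hw]

variable {b : LieSubalgebra ℂ g}

variable (V b) in
/-- The action of `S(Z'')` on a module. -/
def symAct : SymmetricAlgebra ℂ (centralPart b) →ₐ[ℂ] End ℂ V :=
  (envAct V).comp ((Subalgebra.val _).comp (symToCenter b))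

theorem symAct_eq (r : SymmetricAlgebra ℂ (centralPart b)) (m : V) :
    symAct V b r m = envAct V (symToCenter b r : UniversalEnvelopingAlgebra ℂ g) m := rfl

@[simp] theorem symAct_ι (z : centralPart b) (m : V) :
    symAct V b (SymmetricAlgebra.ι ℂ _ z) m = ⁅(z : g), m⁆ := by
  rw [symAct_eq, symToCenter, SymmetricAlgebra.lift_ι_apply]
  exact envAct_ι _ _

theorem symAct_envAct (r : SymmetricAlgebra ℂ (centralPart b))
    (u : UniversalEnvelopingAlgebra ℂ g) (m : V) :
    symAct V b r (envAct V u m) = envAct V u (symAct V b r m) := by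
  rw [symAct_eq, symAct_eq, ← Module.End.mul_apply, ← Module.End.mul_apply, ← map_mul, ← map_mul,
    (Subalgebra.mem_center_iff.1 (symToCenter b r).2 u)]

theorem symAct_lie (r : SymmetricAlgebra ℂ (centralPart b)) (u : g) (m : V) :
    symAct V b r ⁅u, m⁆ = ⁅u, symAct V b r m⁆ := by
  rw [← envAct_ι, symAct_envAct, envAct_ι]

theorem symAct_mem (N : LieSubmodule ℂ g V) (r : SymmetricAlgebra ℂ (centralPart b)) {m : V}
    (hm : m ∈ N) : symAct V b r m ∈ N :=
  envAct_mem N _ hm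

theorem map_symAct (F : V →ₗ⁅ℂ, g⁆ W) (r : SymmetricAlgebra ℂ (centralPart b)) (m : V) :
    F (symAct V b r m) = symAct W b r (F m) :=
  map_envAct F _ m

variable (V) in
/-- The action of an element of `S(Z'')` as an endomorphism of the `g`-module. -/
def symHom (r : SymmetricAlgebra ℂ (centralPart b)) : V →ₗ⁅ℂ, g⁆ V :=
  { symAct V b r with map_lie' := fun {u m} => symAct_lie r u m }

theorem symHom_apply (r : SymmetricAlgebra ℂ (centralPart b)) (m : V) :
    symHom V r m = symAct V b r m := rfl

/-- A module homomorphism vanishing on a generator is zero. -/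
theorem hom_eq_zero {v : V} (hgen : LieSubmodule.lieSpan ℂ g {v} = ⊤) {F : V →ₗ⁅ℂ, g⁆ W}
    (hv : F v = 0) (m : V) : F m = 0 := by
  have : LieSubmodule.lieSpan ℂ g {v} ≤ F.ker :=
    LieSubmodule.lieSpan_le.2 (Set.singleton_subset_iff.2 ((F.mem_ker).2 hv))
  rw [hgen] at this
  exact (F.mem_ker).1 (this (LieSubmodule.mem_top m))

theorem eq_top_of_mem {v : V} (hgen : LieSubmodule.lieSpan ℂ g {v} = ⊤) {N : LieSubmodule ℂ g V}
    (hv : v ∈ N) : N = ⊤ := by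
  rw [eq_top_iff, ← hgen]
  exact LieSubmodule.lieSpan_le.2 (Set.singleton_subset_iff.2 hv)

end Action

section Universal

variable {n : LieSubalgebra ℂ g} (φ : LieAlgebra.LieCharacter ℂ n)
  {V : Type*} [AddCommGroup V] [Module ℂ V] [LieRingModule g V] [LieModule ℂ g V]

theorem envAct_universal (u : UniversalEnvelopingAlgebra ℂ g) (m : Universal φ) :
    envAct (Universal φ) u m = u • m := by
  induction u using enveloping_induction generalizing m with
  | algebraMap t => rw [AlgHom.commutes, Module.algebraMap_end_apply, algebraMap_smul]
  | ι y => rw [envAct_ι, lie_eq_smul]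
  | add u w hu hw => rw [map_add, LinearMap.add_apply, hu, hw, add_smul]
  | mul u w hu hw => rw [map_mul, Module.End.mul_apply, hw, hu, mul_smul]

/-- The canonical generator of the universal Whittaker module. -/
def univGen : Universal φ := Submodule.Quotient.mk (1 ⊗ₜ[ℂ] (1 : ℂ))

theorem mk_tmul (u : UniversalEnvelopingAlgebra ℂ g) (t : ℂ) :
    (Submodule.Quotient.mk (u ⊗ₜ[ℂ] t) : Universal φ) = t • u • univGen φ := by
  rw [univGen, ← Submodule.Quotient.mk_smul, ← Submodule.Quotient.mk_smul,
    TensorProduct.smul_tmul', smul_eq_mul, mul_one, TensorProduct.smul_tmul', TensorProduct.smul_tmul,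
    smul_eq_mul, mul_one]

theorem univGen_isWhittakerVector : IsWhittakerVector φ (univGen φ) := by
  intro y
  have h : (Submodule.Quotient.mk (((1 : UniversalEnvelopingAlgebra ℂ g) *
      envelopingMap n (UniversalEnvelopingAlgebra.ι ℂ y)) ⊗ₜ[ℂ] (1 : ℂ)) : Universal φ) =
      Submodule.Quotient.mk ((1 : UniversalEnvelopingAlgebra ℂ g) ⊗ₜ[ℂ]
        (UniversalEnvelopingAlgebra.lift ℂ φ (UniversalEnvelopingAlgebra.ι ℂ y) * (1 : ℂ))) :=
    (Submodule.Quotient.eq _).2 (Submodule.subset_span ⟨_, _, _, rfl⟩)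
  rw [mk_tmul, mk_tmul, one_smul, one_mul, mul_one, one_smul, envelopingMap,
    UniversalEnvelopingAlgebra.lift_ι_apply, UniversalEnvelopingAlgebra.lift_ι_apply] at h
  exact h

theorem lieSpan_univGen : LieSubmodule.lieSpan ℂ g {univGen φ} = ⊤ := by
  rw [eq_top_iff]
  rintro m -
  obtain ⟨t, rfl⟩ := Submodule.Quotient.mk_surjective _ m
  induction t using TensorProduct.induction_on with
  | zero => exact Submodule.zero_mem _
  | tmul u t =>
    rw [mk_tmul, ← envAct_universal]
    exact Submodule.smul_mem _ _ (envAct_mem _ _ (LieSubmodule.subset_lieSpan rfl))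
  | add s t hs ht => exact Submodule.add_mem _ hs ht

theorem envAct_envelopingMap {v : V} (hv : IsWhittakerVector φ v)
    (r : UniversalEnvelopingAlgebra ℂ n) :
    envAct V (envelopingMap n r) v = UniversalEnvelopingAlgebra.lift ℂ φ r • v := by
  induction r using enveloping_induction with
  | algebraMap t =>
    rw [AlgHom.commutes, AlgHom.commutes, AlgHom.commutes, Module.algebraMap_end_apply]
    rfl
  | ι y =>
    rw [envelopingMap, UniversalEnvelopingAlgebra.lift_ι_apply,
      UniversalEnvelopingAlgebra.lift_ι_apply]
    exact (envAct_ι _ _).trans (hv y)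
  | add u w hu hw => rw [map_add, map_add, map_add, LinearMap.add_apply, hu, hw, add_smul]
  | mul u w hu hw =>
    rw [map_mul, map_mul, map_mul, Module.End.mul_apply, hw, map_smul, hu, smul_smul, mul_comm]

/-- The universal property of the universal Whittaker module. -/
theorem exists_universal_hom {v : V} (hv : IsWhittakerVector φ v) :
    ∃ F : Universal φ →ₗ⁅ℂ, g⁆ V, F (univGen φ) = v := by
  let _ : Module (UniversalEnvelopingAlgebra ℂ g) V := Module.compHom V (envAct V).toRingHom
  have hsmul : ∀ (u : UniversalEnvelopingAlgebra ℂ g) (m : V), u • m = envAct V u m :=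
    fun _ _ => rfl
  have : IsScalarTower ℂ (UniversalEnvelopingAlgebra ℂ g) V :=
    ⟨fun t u m => by rw [hsmul, hsmul, map_smul, LinearMap.smul_apply]⟩
  let f : UniversalEnvelopingAlgebra ℂ g ⊗[ℂ] ℂ →ₗ[UniversalEnvelopingAlgebra ℂ g] V :=
    (LinearMap.toSpanSingleton (UniversalEnvelopingAlgebra ℂ g) V v).comp
      (TensorProduct.AlgebraTensorModule.rid ℂ (UniversalEnvelopingAlgebra ℂ g)
        (UniversalEnvelopingAlgebra ℂ g)).toLinearMap
  have hf : ∀ u (t : ℂ), f (u ⊗ₜ t) = t • u • v := by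
    intro u t
    simp [f]
  have hker : balancedRelations φ ≤ LinearMap.ker f := by
    rw [balancedRelations, Submodule.span_le]
    rintro _ ⟨u, r, t, rfl⟩
    rw [SetLike.mem_coe, LinearMap.mem_ker, map_sub, hf, hf, mul_smul, hsmul (envelopingMap n r),
      envAct_envelopingMap φ hv, smul_comm u, smul_smul, mul_comm, sub_self]
  let F := (balancedRelations φ).liftQ f hker
  have hF : ∀ t, F (Submodule.Quotient.mk t) = f t := fun t => rfl
  refine ⟨{ toFun := F, map_add' := map_add F, map_smul' := fun t m => ?_,
            map_lie' := fun {y m} => ?_ }, ?_⟩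
  · exact LinearMap.map_smul_of_tower F t m
  · change F ⁅y, m⁆ = ⁅y, F m⁆
    rw [lie_eq_smul, map_smul, hsmul, envAct_ι]
  · change F (univGen φ) = v
    rw [univGen, hF, hf, one_smul, one_smul]

end Universal

end Modules

/-! ### From nonsingularity to the structure of Whittaker modules -/

section Main

variable {Q : Type*} [AddCommGroup Q] [LinearOrder Q] [IsOrderedAddMonoid Q]
  {g : Type*} [LieRing g] [LieAlgebra ℂ g] {G : Q → Submodule ℂ g} [GradedLieAlgebra G]
  {π : Q →+o ℤ} {x : Q → g} {φ : LieAlgebra.LieCharacter ℂ (posPart G π)}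

theorem mem_posPart {c : Q} (hc : 0 < π c) {u : g} (hu : u ∈ G c) : u ∈ posPart G π :=
  Submodule.mem_iSup_of_mem (p := fun a => ⨆ _ : 0 < π a, G a) c
    (Submodule.mem_iSup_of_mem (p := fun _ : 0 < π c => G c) hc hu)

theorem mem_nonposPart {c : Q} (hc : π c ≤ 0) {u : g} (hu : u ∈ G c) : u ∈ nonposPart G π :=
  Submodule.mem_iSup_of_mem (p := fun a => ⨆ _ : π a ≤ 0, G a) c
    (Submodule.mem_iSup_of_mem (p := fun _ : π c ≤ 0 => G c) hc hu)

theorem isCompl_parts : IsCompl (posPart G π).toSubmodule (nonposPart G π).toSubmodule := by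
  have hint := DirectSum.Decomposition.isInternal G
  have h1 : (posPart G π).toSubmodule = ⨆ a ∈ {a | 0 < π a}, G a := rfl
  have h2 : (nonposPart G π).toSubmodule = ⨆ a ∈ {a | π a ≤ 0}, G a := rfl
  rw [h1, h2]
  constructor
  · refine hint.submodule_iSupIndep.disjoint_biSup_biSup ?_
    rw [Set.disjoint_left]
    intro a (h : 0 < π a) (h' : π a ≤ 0)
    omega
  · rw [codisjoint_iff, eq_top_iff, ← hint.submodule_iSup_eq_top]
    refine iSup_le fun c => ?_
    rcases lt_or_ge 0 (π c) with h | h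
    · exact le_sup_of_le_left (le_biSup G (i := c) h)
    · exact le_sup_of_le_right (le_biSup G (i := c) h)

/-- Outside R'' the vector x_c is not central, so its class spans the line (𝔤/Z)_c; in the remaining
degrees 𝔤_c is central or zero. -/
theorem exists_eq_smul_add (hgood : IsGood G π) (hx : IsChoice G π x) {c : Q} (hc : π c ≤ 0) {u : g}
    (hu : u ∈ G c) : ∃ z ∈ centralPart (nonposPart G π), ∃ t : ℂ, u = t • x c + z ∧
      (t = 0 ∨ c ∈ nonposDegrees G π \ centralNonposDegrees G π) := by
  by_cases hcP : c ∈ nonposDegrees G π \ centralNonposDegrees G π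
  · have hc' : c ∈ degrees G \ centralNonposDegrees G π := ⟨hcP.1.1, hcP.2⟩
    have hxG := hx.mem c hc'
    have hxZ : x c ∉ (LieAlgebra.center ℂ g).toSubmodule := fun h =>
      hx.notMem c hc' ⟨h, mem_nonposPart hc hxG⟩
    obtain ⟨⟨w, hw⟩, hspan⟩ := rank_le_one_iff.1 (hgood.rank_nonpos c hc)
    obtain ⟨r, hr⟩ := hspan ⟨_, Submodule.mem_map_of_mem hxG⟩
    obtain ⟨s, hs⟩ := hspan ⟨_, Submodule.mem_map_of_mem hu⟩
    replace hr : r • w = (LieAlgebra.center ℂ g).toSubmodule.mkQ (x c) := congrArg Subtype.val hr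
    replace hs : s • w = (LieAlgebra.center ℂ g).toSubmodule.mkQ u := congrArg Subtype.val hs
    have hr0 : r ≠ 0 := by
      rintro rfl
      rw [zero_smul] at hr
      exact hxZ ((Submodule.Quotient.mk_eq_zero _).1 hr.symm)
    have hz : u - (s * r⁻¹) • x c ∈ (LieAlgebra.center ℂ g).toSubmodule := by
      rw [← Submodule.Quotient.mk_eq_zero, Submodule.Quotient.mk_sub, Submodule.Quotient.mk_smul]
      change (LieAlgebra.center ℂ g).toSubmodule.mkQ u -
        (s * r⁻¹) • (LieAlgebra.center ℂ g).toSubmodule.mkQ (x c) = 0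
      rw [← hr, ← hs, smul_smul, inv_mul_cancel_right₀ hr0, sub_self]
    refine ⟨_, ⟨hz, mem_nonposPart hc (Submodule.sub_mem _ hu (Submodule.smul_mem _ _ hxG))⟩,
      s * r⁻¹, ?_, Or.inr hcP⟩
    abel
  · refine ⟨u, ⟨?_, mem_nonposPart hc hu⟩, 0, by simp, Or.inl rfl⟩
    by_cases hdeg : c ∈ degrees G
    · have : c ∈ centralNonposDegrees G π := by
        by_contra h
        exact hcP ⟨⟨hdeg, hc⟩, h⟩
      have h := this.1.2
      rw [← h] at hu
      exact hu.1
    · have : G c = ⊥ := not_not.1 hdeg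
      rw [this, Submodule.mem_bot] at hu
      rw [hu]
      exact Submodule.zero_mem _

theorem exists_whittakerData (hgood : IsGood G π) (hx : IsChoice G π x)
    (hφ : IsNonsingular G π x φ)
    {B : Type*} [CommRing B] [Algebra ℂ B]
    {V : Type*} [AddCommGroup V] [Module ℂ V] [Module B V] [IsScalarTower ℂ B V]
    {ρ : g →ₗ⁅ℂ⁆ End B V} {v : V} (hv : ∀ u : posPart G π, ρ u v = φ u • v)
    (hZ : ∀ z ∈ centralPart (nonposPart G π), ∃ b : B, ∀ m : V, ρ z m = b • m) :
    ∃ (P : Set Q) (a : Q) (ψ : g →ₗ[ℂ] ℂ), WhittakerData G π x P a ψ ρ v := by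
  -- The extension is arbitrary: the argument uses ψ only in degrees positive under π.
  obtain ⟨ψ, hψ⟩ := LinearMap.exists_extend (p := (posPart G π).toSubmodule) (φ : _ →ₗ[ℂ] ℂ)
  replace hψ : ∀ u (hu : u ∈ posPart G π), ψ u = φ ⟨u, hu⟩ := fun u hu =>
    DFunLike.congr_fun hψ (⟨u, hu⟩ : (posPart G π).toSubmodule)
  obtain ⟨a, ha, -, hns⟩ := hφ
  have hpos : 0 < π a := ha.1.1.2
  refine ⟨nonposDegrees G π \ centralNonposDegrees G π, a, ψ, ?_⟩
  refine ⟨fun b hb => hb.1.2, fun b hb => hx.mem b ⟨hb.1.1, hb.2⟩, hpos, ?_, ?_, ?_, ?_⟩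
  · intro c hc u hu
    obtain ⟨z, hz, t, h, h'⟩ := exists_eq_smul_add hgood hx hc hu
    exact ⟨z, t, h, h', hZ z hz⟩
  · intro c hac u hu
    have hc : 0 < π c := lt_of_lt_of_le hpos (OrderHomClass.mono π hac.le)
    by_cases hu0 : u = 0
    · rw [hu0, map_zero]
    have hdeg : c ∈ degrees G := fun h => hu0 (by rwa [h, Submodule.mem_bot] at hu)
    have hc' : c ∈ degrees G \ centralNonposDegrees G π :=
      ⟨hdeg, fun h => not_lt.2 h.2.2 hc⟩
    have hxG := hx.mem c hc'
    obtain ⟨⟨w, hw⟩, hspan⟩ := rank_le_one_iff.1 (hgood.rank_pos c hc)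
    obtain ⟨r, hr⟩ := hspan ⟨_, hxG⟩
    obtain ⟨s, hs⟩ := hspan ⟨_, hu⟩
    replace hr : r • w = x c := congrArg Subtype.val hr
    replace hs : s • w = u := congrArg Subtype.val hs
    have hr0 : r ≠ 0 := by
      rintro rfl
      rw [zero_smul] at hr
      exact hx.ne_zero c hc' hr.symm
    -- Otherwise c would lie in the support of φ, above its maximal element.
    have hxψ : ψ (x c) = 0 := by
      by_contra h
      have hmem : c ∈ support G π x φ :=
        ⟨⟨hdeg, hc⟩, mem_posPart hc hxG, by rwa [hψ _ (mem_posPart hc hxG)] at h⟩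
      exact absurd (ha.2 hmem hac.le) (not_le.2 hac)
    rw [← hr, map_smul, smul_eq_zero, or_iff_right hr0] at hxψ
    rw [← hs, map_smul, hxψ, smul_zero]
  · intro b hb
    obtain ⟨y, -, hy, h, hne⟩ := hns b hb
    exact ⟨y, hy, by rwa [hψ _ h]⟩
  · intro c hc u hu
    rw [hψ u (mem_posPart hc hu)]
    exact hv ⟨u, mem_posPart hc hu⟩

section Structure

variable {V : Type*} [AddCommGroup V] [Module ℂ V] [LieRingModule g V] [LieModule ℂ g V]

/-- Let `I` annihilate a Whittaker module in such a way that it is the annihilator of the generator.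
Then every nonzero submodule contains a multiple of the generator by an element outside `I`, and
elements acting with the generator in their range are invertible modulo `I`. -/
theorem whittaker_structure (hgood : IsGood G π) (hx : IsChoice G π x)
    (hφ : IsNonsingular G π x φ)
    {I : Ideal (SymmetricAlgebra ℂ (centralPart (nonposPart G π)))}
    (hI : ∀ r ∈ I, symAct V (nonposPart G π) r = 0) {v : V} (hv : IsWhittakerVector φ v)
    (hgen : LieSubmodule.lieSpan ℂ g {v} = ⊤)
    (hfaith : ∀ r, symAct V (nonposPart G π) r v = 0 → r ∈ I) :
    (∀ N : LieSubmodule ℂ g V, N ≠ ⊥ → ∃ r, r ∉ I ∧ symAct V (nonposPart G π) r v ∈ N) ∧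
      ∀ r m, symAct V (nonposPart G π) r m = v → ∃ s, r * s - 1 ∈ I := by
  let A := SymmetricAlgebra ℂ (centralPart (nonposPart G π))
  let f : A ⧸ I →+* End ℂ V := Ideal.Quotient.lift I (symAct V (nonposPart G π)).toRingHom hI
  let _ : Module (A ⧸ I) V := Module.compHom V f
  have hmk : ∀ (r : A) (m : V),
      (Ideal.Quotient.mk I r) • m = symAct V (nonposPart G π) r m := fun _ _ => rfl
  have : IsScalarTower ℂ (A ⧸ I) V := ⟨fun t r m => by
    obtain ⟨r, rfl⟩ := Ideal.Quotient.mk_surjective r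
    have h : t • Ideal.Quotient.mk I r = Ideal.Quotient.mk I (t • r) := rfl
    rw [h, hmk, hmk, map_smul, LinearMap.smul_apply]⟩
  let ρ : g →ₗ⁅ℂ⁆ End (A ⧸ I) V :=
    { toFun := fun u =>
        { toFun := fun m => ⁅u, m⁆
          map_add' := lie_add u
          map_smul' := fun r m => by
            obtain ⟨r, rfl⟩ := Ideal.Quotient.mk_surjective r
            rw [hmk, RingHom.id_apply, hmk, symAct_lie] }
      map_add' := fun u w => LinearMap.ext fun m => add_lie u w m
      map_smul' := fun t u => LinearMap.ext fun m => smul_lie t u m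
      map_lie' := fun {u w} => LinearMap.ext fun m => lie_lie u w m }
  have hρ : ∀ u m, ρ u m = ⁅u, m⁆ := fun _ _ => rfl
  obtain ⟨P, a, ψ, D⟩ := exists_whittakerData (ρ := ρ) (v := v) hgood hx hφ hv (fun z hz =>
    ⟨Ideal.Quotient.mk I (SymmetricAlgebra.ι ℂ _ ⟨z, hz⟩), fun m => by rw [hmk, symAct_ι, hρ]⟩)
  have hsurj : Function.Surjective (theta x P ρ v) := by
    refine D.theta_surjective fun W hvW hW => ?_
    let N : LieSubmodule ℂ g V :=
      { W.restrictScalars ℂ with lie_mem := fun {u m} hm => hW u m hm }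
    have hN : N = ⊤ := eq_top_of_mem hgen (show v ∈ N from hvW)
    rw [eq_top_iff]
    rintro m -
    have : m ∈ N := hN ▸ LieSubmodule.mem_top m
    exact this
  constructor
  · intro N hN
    obtain ⟨m, hm, hm0⟩ := N.toSubmodule.exists_mem_ne_zero_of_ne_bot (by simpa using hN)
    obtain ⟨c, rfl⟩ := hsurj m
    let W : Submodule (A ⧸ I) V :=
      { N.toSubmodule with
        smul_mem' := fun r m hm => by
          obtain ⟨r, rfl⟩ := Ideal.Quotient.mk_surjective r
          exact symAct_mem N r hm }
    obtain ⟨b, hb, hbv⟩ := D.exists_smul_mem (W := W) (fun u m hm => N.lie_mem hm)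
      (c := c) (fun h => hm0 (by rw [h, map_zero])) hm
    obtain ⟨r, rfl⟩ := Ideal.Quotient.mk_surjective b
    exact ⟨r, fun h => hb (Ideal.Quotient.eq_zero_iff_mem.2 h), hbv⟩
  · intro r m hm
    have hinj : Function.Injective (theta x P ρ v) := D.theta_injective fun b hb => by
      obtain ⟨r, rfl⟩ := Ideal.Quotient.mk_surjective b
      exact Ideal.Quotient.eq_zero_iff_mem.2 (hfaith r hb)
    obtain ⟨c, rfl⟩ := hsurj m
    have h1 : theta x P ρ v (Ideal.Quotient.mk I r • c) = theta x P ρ v (Finsupp.single 0 1) := by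
      rw [map_smul, hmk, hm, theta, Finsupp.linearCombination_single, one_smul,
        Multiset.toList_zero, word_nil]
    -- The constant coefficient of m, read off at the empty multiset, is the inverse of r modulo I.
    have h2 := DFunLike.congr_fun (hinj h1) 0
    obtain ⟨s, hs⟩ := Ideal.Quotient.mk_surjective (c 0)
    rw [Finsupp.smul_apply, smul_eq_mul, Finsupp.single_eq_same, ← hs] at h2
    refine ⟨s, ?_⟩
    rw [← Ideal.Quotient.eq_zero_iff_mem, map_sub, map_mul, h2, map_one, sub_self]

end Structure

end Main
-- Nonvanishing and simplicity of M_φ / 𝔪 M_φ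
section Simple

variable {Q : Type*} [AddCommGroup Q] [LinearOrder Q] [IsOrderedAddMonoid Q]
  {g : Type*} [LieRing g] [LieAlgebra ℂ g] {G : Q → Submodule ℂ g} [GradedLieAlgebra G]
  {π : Q →+o ℤ} {x : Q → g} {φ : LieAlgebra.LieCharacter ℂ (posPart G π)}

theorem lie_of_mem_center {z : g} (hz : z ∈ LieAlgebra.center ℂ g) (y : g) : ⁅z, y⁆ = 0 := by
  rw [← lie_skew, (LieModule.mem_maxTrivSubmodule (R := ℂ) (L := g) (M := g) z).1 hz y, neg_zero]

theorem lie_add_center {z z' : g} (hz : z ∈ LieAlgebra.center ℂ g)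
    (hz' : z' ∈ LieAlgebra.center ℂ g) (u w : g) : ⁅u + z, w + z'⁆ = ⁅u, w⁆ := by
  rw [add_lie, lie_of_mem_center hz, add_zero, lie_add, ← lie_skew u z', lie_of_mem_center hz',
    neg_zero, add_zero]

/-- The subalgebra `𝔫 + Z''`. -/
def posCentral (G : Q → Submodule ℂ g) [GradedLieAlgebra G] (π : Q →+o ℤ) : LieSubalgebra ℂ g :=
  { (posPart G π).toSubmodule ⊔ centralPart (nonposPart G π) with
    lie_mem' := by
      intro u w hu hw
      obtain ⟨u, hu', z, hz, rfl⟩ := Submodule.mem_sup.1 hu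
      obtain ⟨w, hw', z', hz', rfl⟩ := Submodule.mem_sup.1 hw
      rw [lie_add_center hz.1 hz'.1]
      exact Submodule.mem_sup_left ((posPart G π).lie_mem hu' hw') }

/-- A linear form which restricts to `φ` on `𝔫` and to a given map on `Z''`. -/
theorem exists_linear_form {R : Type*} [CommRing R] [Algebra ℂ R]
    (χ : centralPart (nonposPart G π) →ₗ[ℂ] R) :
    ∃ lam : g →ₗ[ℂ] R, (∀ u : posPart G π, lam u = algebraMap ℂ R (φ u)) ∧
      ∀ z : centralPart (nonposPart G π), lam z = χ z := by
  obtain ⟨χ', hχ⟩ := LinearMap.exists_extend χ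
  let p := (posPart G π).toSubmodule
  let q := (nonposPart G π).toSubmodule
  let f : p →ₗ[ℂ] R := (Algebra.linearMap ℂ R).comp (φ : posPart G π →ₗ[ℂ] ℂ)
  have h : IsCompl p q := isCompl_parts
  refine ⟨LinearMap.ofIsCompl h f (χ'.comp q.subtype), fun u => ?_, fun z => ?_⟩
  · exact LinearMap.ofIsCompl_apply_left h u
  · exact (LinearMap.ofIsCompl_apply_right h ⟨z, z.2.2⟩).trans (DFunLike.congr_fun hχ z)

/-- The homomorphism from M_φ sending the generator to v kills I M_φ: composed with the action of r
in I it is again a homomorphism, and it vanishes on the generator. Any model with v ≠ 0 therefore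
detects that the quotient is nonzero. -/
theorem eq_zero_of_univGen_mem {I : Ideal (SymmetricAlgebra ℂ (centralPart (nonposPart G π)))}
    {R : Type*} [CommRing R] [Algebra ℂ R]
    {q : SymmetricAlgebra ℂ (centralPart (nonposPart G π)) →ₐ[ℂ] R} (hq : ∀ r ∈ I, q r = 0)
    {N : Type*} [AddCommGroup N] [Module ℂ N] [Module R N] [IsScalarTower ℂ R N]
    {ρ : g →ₗ⁅ℂ⁆ End R N} {v : N} (hv : ∀ u : posPart G π, ρ u v = φ u • v)
    (hz : ∀ z : centralPart (nonposPart G π), ρ z v = q (SymmetricAlgebra.ι ℂ _ z) • v)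
    (h : univGen φ ∈ idealSMul φ (nonposPart G π) I) : v = 0 := by
  let _ : LieRingModule g N :=
    { bracket := fun u m => ρ u m
      add_lie := fun u w m => by rw [map_add]; rfl
      lie_add := fun u m m' => map_add (ρ u) m m'
      leibniz_lie := fun u w m => rho_comm (ρ := ρ) u w m |>.trans (add_comm _ _) }
  have hbr : ∀ (u : g) (m : N), ⁅u, m⁆ = ρ u m := fun _ _ => rfl
  have : LieModule ℂ g N :=
    { smul_lie := fun t u m => by rw [hbr, map_smul]; rfl
      lie_smul := fun t u m => LinearMap.map_smul_of_tower (ρ u) t m }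
  have henv : ∀ (u : UniversalEnvelopingAlgebra ℂ g) (r : R) (m : N),
      envAct N u (r • m) = r • envAct N u m := by
    intro u r m
    induction u using enveloping_induction generalizing m with
    | algebraMap t => rw [AlgHom.commutes, algebraMap_end_apply, algebraMap_end_apply, smul_comm]
    | ι y => rw [envAct_ι, envAct_ι, hbr, hbr, map_smul]
    | add u w hu hw => simp only [map_add, LinearMap.add_apply, hu, hw, smul_add]
    | mul u w hu hw => simp only [map_mul, End.mul_apply, hu, hw]
  have hsym : ∀ r, symAct N (nonposPart G π) r v = q r • v := by
    intro r
    induction r using SymmetricAlgebra.induction with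
    | algebraMap t =>
      rw [AlgHom.commutes, AlgHom.commutes, algebraMap_end_apply, algebraMap_smul]
    | ι z => rw [symAct_ι, hbr, hz]
    | mul r r' h h' =>
      rw [map_mul, map_mul, End.mul_apply, h', symAct_eq, henv, ← symAct_eq, h, smul_smul, mul_comm]
    | add r r' h h' => rw [map_add, map_add, LinearMap.add_apply, h, h', add_smul]
  obtain ⟨F, hF⟩ := exists_universal_hom φ (V := N) (v := v) hv
  have hker : idealSMul φ (nonposPart G π) I ≤ F.ker := by
    refine Submodule.span_le.2 ?_
    rintro _ ⟨r, hr, m, rfl⟩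
    refine F.mem_ker.2 ?_
    rw [← envAct_universal, ← symAct_eq]
    refine hom_eq_zero (lieSpan_univGen φ) (F := F.comp (symHom (Universal φ) r)) ?_ m
    rw [LieModuleHom.comp_apply, symHom_apply, map_symAct, hF, hsym, hq r hr, zero_smul]
  rw [← hF]
  exact F.mem_ker.1 (hker h)

/-- The model is induced from 𝔫 + Z'' with coefficients A/I, where 𝔫 acts on the generator by φ and
Z'' by its image in A/I. These combine into one linear form because 𝔫 and 𝔟₋ are complementary, and
the form kills brackets because Z'' is central and φ is a character. -/
theorem univGen_notMem {I : Ideal (SymmetricAlgebra ℂ (centralPart (nonposPart G π)))}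
    (hI : I ≠ ⊤) : univGen φ ∉ idealSMul φ (nonposPart G π) I := by
  have : Nontrivial (SymmetricAlgebra ℂ (centralPart (nonposPart G π)) ⧸ I) :=
    Ideal.Quotient.nontrivial_iff.2 hI
  obtain ⟨lam, hlam, hlam'⟩ := exists_linear_form (φ := φ)
    ((Ideal.Quotient.mkₐ ℂ I).toLinearMap.comp (SymmetricAlgebra.ι ℂ _))
  obtain ⟨C, s, ρ, hρ⟩ := Induced.exists_representation (posCentral G π) lam (by
    intro u hu w hw
    obtain ⟨u, hu', z, hz, rfl⟩ := Submodule.mem_sup.1 hu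
    obtain ⟨w, hw', z', hz', rfl⟩ := Submodule.mem_sup.1 hw
    rw [lie_add_center hz.1 hz'.1]
    have h := hlam ⁅(⟨u, hu'⟩ : posPart G π), (⟨w, hw'⟩ : posPart G π)⁆
    rw [LieAlgebra.lieCharacter_apply_lie, map_zero] at h
    exact h)
  intro h
  refine one_ne_zero (Finsupp.single_eq_zero.1 (eq_zero_of_univGen_mem
    (q := Ideal.Quotient.mkₐ ℂ I) (v := Finsupp.single 0 1)
    (fun r hr => Ideal.Quotient.eq_zero_iff_mem.2 hr) (ρ := ρ)
    (fun u => ?_) (fun z => ?_) h))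
  · rw [hρ u (Submodule.mem_sup_left u.2), hlam, algebraMap_smul]
  · rw [hρ z (Submodule.mem_sup_right z.2), hlam']
    rfl

theorem symAct_universalQuotient {b : LieSubalgebra ℂ g}
    {I : Ideal (SymmetricAlgebra ℂ (centralPart b))} {r : SymmetricAlgebra ℂ (centralPart b)}
    (hr : r ∈ I) : symAct (UniversalQuotient φ b I) b r = 0 := by
  ext m
  obtain ⟨m, rfl⟩ := Submodule.Quotient.mk_surjective _ m
  change symAct (UniversalQuotient φ b I) b r (LieSubmodule.Quotient.mk' (idealSMul φ b I) m) = 0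
  rw [← map_symAct]
  refine (LieSubmodule.Quotient.mk_eq_zero (N := idealSMul φ b I)).2
    (Submodule.subset_span ⟨r, hr, m, ?_⟩)
  rw [symAct_eq, envAct_universal]

/-- The image of the canonical generator in a quotient. -/
abbrev quotGen (φ : LieAlgebra.LieCharacter ℂ (posPart G π)) (b : LieSubalgebra ℂ g)
    (I : Ideal (SymmetricAlgebra ℂ (centralPart b))) : UniversalQuotient φ b I :=
  LieSubmodule.Quotient.mk' (idealSMul φ b I) (univGen φ)

theorem quotGen_isWhittakerVector (b : LieSubalgebra ℂ g)
    (I : Ideal (SymmetricAlgebra ℂ (centralPart b))) : IsWhittakerVector φ (quotGen φ b I) := by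
  intro u
  rw [quotGen, ← LieModuleHom.map_lie, univGen_isWhittakerVector, map_smul]

theorem lieSpan_quotGen (b : LieSubalgebra ℂ g)
    (I : Ideal (SymmetricAlgebra ℂ (centralPart b))) :
    LieSubmodule.lieSpan ℂ g {quotGen φ b I} = ⊤ := by
  have h : (LieSubmodule.lieSpan ℂ g {quotGen φ b I}).comap
      (LieSubmodule.Quotient.mk' (idealSMul φ b I)) = ⊤ :=
    eq_top_of_mem (lieSpan_univGen φ) (LieSubmodule.subset_lieSpan rfl)
  rw [eq_top_iff]
  rintro m -
  obtain ⟨m, rfl⟩ := Submodule.Quotient.mk_surjective _ m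
  have : m ∈ (LieSubmodule.lieSpan ℂ g {quotGen φ b I}).comap
      (LieSubmodule.Quotient.mk' (idealSMul φ b I)) := h ▸ LieSubmodule.mem_top m
  exact this

/-- Elements outside a maximal I act invertibly. Hence the annihilator of the nonzero generator is
no larger than I, and a submodule containing r v with r outside I contains v. -/
theorem isIrreducible_universalQuotient (hgood : IsGood G π) (hx : IsChoice G π x)
    (hφ : IsNonsingular G π x φ)
    {I : Ideal (SymmetricAlgebra ℂ (centralPart (nonposPart G π)))} (hI : I.IsMaximal) :
    LieModule.IsIrreducible ℂ g (UniversalQuotient φ (nonposPart G π) I) := by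
  have hne : quotGen φ (nonposPart G π) I ≠ 0 := fun h =>
    univGen_notMem hI.ne_top ((LieSubmodule.Quotient.mk_eq_zero
      (N := idealSMul φ (nonposPart G π) I)).1 h)
  have : Nontrivial (UniversalQuotient φ (nonposPart G π) I) := ⟨⟨_, _, hne⟩⟩
  have hinv : ∀ r, r ∉ I → ∃ s, ∀ m : UniversalQuotient φ (nonposPart G π) I,
      symAct _ (nonposPart G π) s (symAct _ (nonposPart G π) r m) = m := by
    intro r hr
    obtain ⟨s, i, hi, hs⟩ := hI.exists_inv hr
    refine ⟨s, fun m => ?_⟩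
    rw [← End.mul_apply, ← map_mul, eq_sub_of_add_eq hs, map_sub, symAct_universalQuotient hi,
      sub_zero, map_one, End.one_apply]
  have hfaith : ∀ r, symAct _ (nonposPart G π) r (quotGen φ (nonposPart G π) I) = 0 → r ∈ I := by
    intro r h
    by_contra hr
    obtain ⟨s, hs⟩ := hinv r hr
    have := hs (quotGen φ (nonposPart G π) I)
    rw [h, map_zero] at this
    exact hne this.symm
  refine LieModule.IsIrreducible.mk fun N hN => ?_
  obtain ⟨r, hr, hN⟩ := (whittaker_structure hgood hx hφ
    (fun r hr => symAct_universalQuotient hr) (quotGen_isWhittakerVector _ I)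
    (lieSpan_quotGen _ I) hfaith).1 N hN
  obtain ⟨s, hs⟩ := hinv r hr
  exact eq_top_of_mem (lieSpan_quotGen _ I) (hs (quotGen φ (nonposPart G π) I) ▸ symAct_mem N s hN)

/-! ### Classification of the simple Whittaker modules -/

section Classification

variable {V : Type*} [AddCommGroup V] [Module ℂ V] [LieRingModule g V] [LieModule ℂ g V]

/-- By centrality an r outside the kernel has a nonzero submodule as range, so v = r m for some m,
and `whittaker_structure` inverts r modulo the kernel. -/
theorem isMaximal_ker_symAct (hgood : IsGood G π) (hx : IsChoice G π x)
    (hφ : IsNonsingular G π x φ) [LieModule.IsIrreducible ℂ g V] {v : V}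
    (hv : IsWhittakerVector φ v) (hgen : LieSubmodule.lieSpan ℂ g {v} = ⊤) :
    (RingHom.ker (symAct V (nonposPart G π))).IsMaximal := by
  have : Nontrivial V := (LieSubmodule.nontrivial_iff ℂ g V).1 inferInstance
  have hker : ∀ {r}, r ∈ RingHom.ker (symAct V (nonposPart G π)) ↔
      symAct V (nonposPart G π) r = 0 := RingHom.mem_ker
  have hstr := (whittaker_structure hgood hx hφ (fun r hr => hker.1 hr) hv hgen
    (fun r hr => hker.2 (LinearMap.ext fun m => hom_eq_zero hgen (F := symHom V r) hr m))).2
  rw [Ideal.isMaximal_iff]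
  constructor
  · rw [hker, map_one]
    exact one_ne_zero
  · intro J r hJ hr hrJ
    have htop : (symHom V r).range = ⊤ := by
      refine (eq_bot_or_eq_top _).resolve_left fun h => hr (hker.2 (LinearMap.ext fun m => ?_))
      have : symHom V r m ∈ (symHom V r).range := ⟨m, rfl⟩
      rwa [h, LieSubmodule.mem_bot] at this
    obtain ⟨m, hm⟩ : v ∈ (symHom V r).range := htop ▸ LieSubmodule.mem_top v
    obtain ⟨s, hs⟩ := hstr r m hm
    have := J.sub_mem (J.mul_mem_right s hrJ) (hJ hs)
    rwa [sub_sub_cancel] at this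

theorem nonempty_equiv_universalQuotient [LieModule.IsIrreducible ℂ g V] {v : V}
    (hv : IsWhittakerVector φ v) (hgen : LieSubmodule.lieSpan ℂ g {v} = ⊤)
    {I : Ideal (SymmetricAlgebra ℂ (centralPart (nonposPart G π)))}
    (hI : ∀ r ∈ I, symAct V (nonposPart G π) r = 0)
    (hirr : LieModule.IsIrreducible ℂ g (UniversalQuotient φ (nonposPart G π) I)) :
    Nonempty (V ≃ₗ⁅ℂ, g⁆ UniversalQuotient φ (nonposPart G π) I) := by
  have : Nontrivial V := (LieSubmodule.nontrivial_iff ℂ g V).1 inferInstance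
  obtain ⟨F, hF⟩ := exists_universal_hom φ hv
  have hker : (idealSMul φ (nonposPart G π) I).toSubmodule ≤
      LinearMap.ker (F : Universal φ →ₗ[ℂ] V) := by
    refine Submodule.span_le.2 ?_
    rintro _ ⟨r, hr, m, rfl⟩
    change F _ = 0
    rw [← envAct_universal, ← symAct_eq, map_symAct, hI r hr, LinearMap.zero_apply]
  let F' : UniversalQuotient φ (nonposPart G π) I →ₗ⁅ℂ, g⁆ V :=
    { (idealSMul φ (nonposPart G π) I).toSubmodule.liftQ (F : Universal φ →ₗ[ℂ] V) hker with
      map_lie' := by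
        intro u m
        obtain ⟨m, rfl⟩ := Submodule.Quotient.mk_surjective _ m
        exact F.map_lie u m }
  have hF' : F' (quotGen φ (nonposPart G π) I) = v := hF
  have hsurj : Function.Surjective F' := by
    rw [← LieModuleHom.range_eq_top]
    exact eq_top_of_mem hgen ⟨_, hF'⟩
  have hinj : Function.Injective F' := by
    rw [← LieModuleHom.ker_eq_bot]
    refine (eq_bot_or_eq_top _).resolve_right fun h => ?_
    obtain ⟨m, hm⟩ := exists_ne (0 : V)
    obtain ⟨m, rfl⟩ := hsurj m
    exact hm (F'.mem_ker.1 (h ▸ LieSubmodule.mem_top m))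
  let e := LinearEquiv.ofBijective (F' : UniversalQuotient φ (nonposPart G π) I →ₗ[ℂ] V)
    ⟨hinj, hsurj⟩
  let E : UniversalQuotient φ (nonposPart G π) I ≃ₗ⁅ℂ, g⁆ V :=
    { F' with
      invFun := e.symm
      left_inv := e.left_inv
      right_inv := e.right_inv }
  exact ⟨E.symm⟩

end Classification
end Simple
end Whittaker

end

theorem corollary4p2p3 {Q : Type*} [AddCommGroup Q] [Module.Free ℤ Q] [LinearOrder Q]
    [IsOrderedAddMonoid Q] {g : Type*} [LieRing g] [LieAlgebra ℂ g]
    (G : Q → Submodule ℂ g) [GradedLieAlgebra G] (π : Q →+o ℤ)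
    (hgood : Whittaker.IsGood G π)
    (x : Q → g) (hx : Whittaker.IsChoice G π x)
    (φ : LieAlgebra.LieCharacter ℂ (Whittaker.posPart G π))
    (hφ : Whittaker.IsNonsingular G π x φ) :
    (∀ m : Ideal (SymmetricAlgebra ℂ (Whittaker.centralPart (Whittaker.nonposPart G π))),
      m.IsMaximal →
        Whittaker.IsWhittakerModule φ
            (Whittaker.UniversalQuotient φ (Whittaker.nonposPart G π) m) ∧
          LieModule.IsIrreducible ℂ g
            (Whittaker.UniversalQuotient φ (Whittaker.nonposPart G π) m)) ∧
    (∀ (V : Type*) [AddCommGroup V] [Module ℂ V] [LieRingModule g V] [LieModule ℂ g V],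
      Whittaker.IsWhittakerModule φ V → LieModule.IsIrreducible ℂ g V →
        ∃! m : Ideal (SymmetricAlgebra ℂ (Whittaker.centralPart (Whittaker.nonposPart G π))),
          m.IsMaximal ∧
            Nonempty (V ≃ₗ⁅ℂ, g⁆
              Whittaker.UniversalQuotient φ (Whittaker.nonposPart G π) m)) := by
  refine ⟨fun m hm => ⟨⟨_, Whittaker.quotGen_isWhittakerVector _ m,
    Whittaker.lieSpan_quotGen _ m⟩,
    Whittaker.isIrreducible_universalQuotient hgood hx hφ hm⟩, ?_⟩
  intro V _ _ _ _ ⟨v, hv, hgen⟩ hirr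
  have hmax := Whittaker.isMaximal_ker_symAct hgood hx hφ hv hgen
  refine ⟨_, ⟨hmax, Whittaker.nonempty_equiv_universalQuotient hv hgen
    (fun r hr => RingHom.mem_ker.1 hr)
    (Whittaker.isIrreducible_universalQuotient hgood hx hφ hmax)⟩, ?_⟩
  rintro m ⟨hm, ⟨E⟩⟩
  -- Since m annihilates M_φ / m M_φ, it annihilates V; being maximal, it equals the annihilator of
  -- V.
  refine hm.eq_of_le hmax.ne_top fun r hr => RingHom.mem_ker.2 (LinearMap.ext fun y => ?_)
  apply E.injective
  have h := Whittaker.map_symAct E.toLieModuleHom r y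
  rw [Whittaker.symAct_universalQuotient hr] at h
  exact h.trans (map_zero E.toLieModuleHom).symm
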